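/- **Notation.** For $\rho,\beta>0$ and $\gamma\in\mathbb R$ let $$E^{\gamma}_{\rho,\beta}(z)=\sum_{k=0}^\infty\frac{(\gamma)_k}{\Gamma(\rho k+\beta)}\frac{z^k}{k!},\qquad (\gamma)_k=\gamma(\gamma+1)\cdots(\gamma+k-1),$$ and for $\omega\in\mathbb C$ let $$(\mathbf E^{\gamma}_{\rho,\beta,\omega,0^+}\varphi)(x)=\int_0^x (x-s)^{\beta-1}E^{\gamma}_{\rho,\beta}\big(\omega(x-s)^\rho\big)\varphi(s)\,ds,$$ with $\mathbf E^{0}_{\rho,0,\omega,0^+}\varphi=\varphi$. Let $L^1_{loc}$ be the set of $\varphi:(0,\infty)\to\mathbb C$ with $\varphi\in L^1[0,b]$ for all $b>0$. For $y\in L^1_{loc}$ such that $\mathbf E^{-\gamma(1-\nu)}_{\rho,(1-\nu)(1-\mu),\omega,0^+}y$ coincides almost everywhere with a function $w$ that is absolutely continuous on $[0,b]$ for every $b>0$, put $$\mathbf D^{\gamma,\mu,\nu}_{\rho,\omega,0^+}y=\mathbf E^{-\gamma\nu}_{\rho,\nu(1-\mu),\omega,0^+}\frac{dw}{dx}.$$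 **Theorem.** Let $\rho>0$, $\mu\in(0,1)$, $\nu\in[0,1]$, $\omega,\lambda\in\mathbb C$, $K,\gamma,\delta\ge 0$ and $f\in L^1[0,\infty)$ (complex-valued). Consider the Cauchy problem $$\mathbf D^{\gamma,\mu,\nu}_{\rho,\omega,0^+}y=\lambda\,\mathbf E^{\delta}_{\rho,\mu,\omega,0^+}y+f\ \text{ a.e. on }(0,\infty),\qquad \big[\mathbf E^{-\gamma(1-\nu)}_{\rho,(1-\nu)(1-\mu),\omega,0^+}y\big]_{x=0^+}=K,$$ for $y\in L^1_{loc}$ in the domain of $\mathbf D^{\gamma,\mu,\nu}_{\rho,\omega,0^+}$ (the initial value is the limit at $0^+$ of the absolutely continuous representative $w$), and the function $$Y(x)=K\sum_{n=0}^\infty \lambda^n x^{\nu(1-\mu)+\mu(2n+1)-1}E^{\gamma-\gamma\nu+n(\delta+\gamma)}_{\rho,\nu(1-\mu)+\mu(2n+1)}(\omega x^\rho)+\sum_{n=0}^\infty \lambda^n\,\big(\mathbf E^{\gamma+n(\delta+\gamma)}_{\rho,(2n+1)\mu,\omega,0^+}f\big)(x).$$ 1. The Mittag-Leffler series in the first sum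 converge for all arguments, and the first sum converges absolutely for every $x>0$; for almost every $x>0$ all the Prabhakar integrals in the second sum exist as Lebesgue integrals and the second sum converges absolutely. 2. Every solution $y$ of the Cauchy problem satisfies $y=Y$ almost everywhere on $(0,\infty)$. 3. $Y$ is a solution of the Cauchy problem if and only if $f$ is in the range of the outer operator in $\mathbf D^{\gamma,\mu,\nu}_{\rho,\omega,0^+}$, that is, $f=\mathbf E^{-\gamma\nu}_{\rho,\nu(1-\mu),\omega,0^+}g$ a.e. on $(0,\infty)$ for some $g\in L^1_{loc}$. In particular, if $\nu=0$, then $Y$ is a solution for every $f\in L^1[0,\infty)$. -/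

import Mathlib

open MeasureTheory Set Filter Topology

noncomputable section

/-- The three-parameter Mittag-Leffler (Prabhakar) function
`E^γ_{ρ,β}(z) = ∑ k, (γ)_k / (Γ(ρ k + β) k!) z ^ k`, where `(γ)_k = γ (γ + 1) ⋯ (γ + k - 1)` is the
Pochhammer symbol, the value (for `γ = 0, -1, -2, …` the limit) of `Γ(γ + k) / Γ(γ)`. -/
def prabhakarE (ρ β γ : ℝ) (z : ℂ) : ℂ :=
  ∑' k : ℕ, (((ascPochhammer ℝ k).eval γ / (Real.Gamma (ρ * k + β) * k.factorial) : ℝ) : ℂ) * z ^ k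

/-- The Prabhakar kernel `e^γ_{ρ,β,ω}(t) = t ^ (β - 1) E^γ_{ρ,β}(ω t ^ ρ)`, for `t > 0`. -/
def prabhakarKernel (ρ β : ℝ) (ω : ℂ) (γ : ℝ) (t : ℝ) : ℂ :=
  ((t ^ (β - 1) : ℝ) : ℂ) * prabhakarE ρ β γ (ω * ((t ^ ρ : ℝ) : ℂ))

open Classical in
/-- The Prabhakar integral
`(𝐄^γ_{ρ,β,ω,0+} φ)(t) = ∫₀ᵗ (t - s) ^ (β - 1) E^γ_{ρ,β}(ω (t - s) ^ ρ) φ(s) ds`,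
with the convention that `𝐄^0_{ρ,0,ω,0+}` is the identity. -/
def prabhakarIntegral (ρ β : ℝ) (ω : ℂ) (γ : ℝ) (φ : ℝ → ℂ) (t : ℝ) : ℂ :=
  if β = 0 ∧ γ = 0 then φ t
  else ∫ s in (0 : ℝ)..t, prabhakarKernel ρ β ω γ (t - s) * φ s

/-- `φ ∈ L¹[0, b]` for every finite `b > 0`. -/
def LocL1 (φ : ℝ → ℂ) : Prop :=
  ∀ b : ℝ, 0 < b → IntegrableOn φ (Ioc 0 b)

/-- `w` is the absolutely continuous representative of `F`: `w` is absolutely continuous on `[0, b]`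
for every `b > 0`, and `w = F` almost everywhere on `(0, ∞)`. -/
def IsACRepresentative (F w : ℝ → ℂ) : Prop :=
  (∀ b : ℝ, 0 < b → AbsolutelyContinuousOnInterval w 0 b) ∧
    w =ᵐ[volume.restrict (Ioi 0)] F

/-- `y` lies in the domain of the Hilfer-Prabhakar derivative `𝐃^{γ,μ,ν}_{ρ,ω,0+}` and `D` is its
derivative: `y ∈ L¹[0, b]` for all `b`, the function `𝐄^{-γ(1-ν)}_{ρ,(1-ν)(1-μ),ω,0+} y` is
absolutely continuous, with representative `w`, and
`D = 𝐄^{-γν}_{ρ,ν(1-μ),ω,0+} (dw/dt)` almost everywhere on `(0, ∞)`. -/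
structure HasHilferPrabhakarDeriv (ρ : ℝ) (ω : ℂ) (γ μ ν : ℝ) (y w D : ℝ → ℂ) : Prop where
  locL1 : LocL1 y
  rep : IsACRepresentative (prabhakarIntegral ρ ((1 - ν) * (1 - μ)) ω (-(γ * (1 - ν))) y) w
  deriv_eq : D =ᵐ[volume.restrict (Ioi 0)]
    prabhakarIntegral ρ (ν * (1 - μ)) ω (-(γ * ν)) (deriv w)

/-- `y` solves the Cauchy problem
`𝐃^{γ,μ,ν}_{ρ,ω,0+} y = lam 𝐄^δ_{ρ,μ,ω,0+} y + f` a.e. on `(0, ∞)`,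
`[𝐄^{-γ(1-ν)}_{ρ,(1-ν)(1-μ),ω,0+} y](0+) = K`. -/
def IsCauchySolution (ρ : ℝ) (ω : ℂ) (γ μ ν δ : ℝ) (lam : ℂ) (K : ℝ) (f y : ℝ → ℂ) : Prop :=
  ∃ w : ℝ → ℂ,
    HasHilferPrabhakarDeriv ρ ω γ μ ν y w
      (fun x => lam * prabhakarIntegral ρ μ ω δ y x + f x) ∧
    Tendsto w (𝓝[>] 0) (𝓝 (K : ℂ))

/-- The function
`K ∑ lam ^ n x ^ (ν(1-μ)+μ(2n+1)-1) E^{γ-γν+n(δ+γ)}_{ρ,ν(1-μ)+μ(2n+1)}(ω x ^ ρ)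
  + ∑ lam ^ n (𝐄^{γ+n(δ+γ)}_{ρ,(2n+1)μ,ω,0+} f)(x)`. -/
def cauchyFormula (ρ : ℝ) (ω : ℂ) (γ μ ν δ : ℝ) (lam : ℂ) (K : ℝ) (f : ℝ → ℂ) (x : ℝ) : ℂ :=
  (K : ℂ) * (∑' n : ℕ, lam ^ n * ((x ^ (ν * (1 - μ) + μ * (2 * n + 1) - 1) : ℝ) : ℂ) *
      prabhakarE ρ (ν * (1 - μ) + μ * (2 * n + 1)) (γ - γ * ν + n * (δ + γ))
        (ω * ((x ^ ρ : ℝ) : ℂ))) +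
    ∑' n : ℕ, lam ^ n * prabhakarIntegral ρ ((2 * n + 1) * μ) ω (γ + n * (δ + γ)) f x

end

-- Every operator in the problem is a convolution on the half-line. Write `e(β,γ)` for the Prabhakar
-- kernel and `E(β,γ)` for convolution with it. The engine is the semigroup law `e(β₁,γ₁) * e(β₂,γ₂)
-- = e(β₁+β₂, γ₁+γ₂)` (`causalConv_prabhakarKernel`), which combines the Beta integral with
-- Vandermonde's identity for `(γ)_k / k!`. Since `e(1,0) = 1`, the operator `E(1,0)` is integration
-- from `0`, which is injective on locally integrable functions.
--
-- Let `A` and `B` be the outer and inner operators of the derivative, and `C = E(ν(1-μ)+μ, γ-γν)`.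
-- The indices of `B` and `C` add up to `(1,0)`, and `C = E(μ,γ) A`. Hence `B y = K + ∫ h` is
-- equivalent to `y = K e(ν(1-μ)+μ, γ-γν) + C h` (`inner_eq_primitive_iff`), and the differential
-- equation reads `A h = λ E(μ,δ) y + f`. Applying `E(μ,γ)` eliminates `h` and leaves a Volterra
-- equation for `y` with kernel `λ e(2μ, δ+γ)`. Its only solution is given by the Neumann series,
-- which the semigroup law sums to `Y`.
--
-- Only the passage back from the Volterra equation can fail, as it requires undoing `E(μ,γ)`. If
-- `y` is a solution then `y = A Z` for some `Z`, so `f = A h - λ E(μ,δ) A Z` lies in the range of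
-- `A`. Conversely, if `f = A g`, let `Z` solve the Volterra equation with data `K e(μ,γ) + E(μ,γ)
-- g`; then `Y = A Z`, and `h = g + λ E(μ,δ) Z` is the required density.
--
-- Convergence rests on `A ^ s / Γ(s) ≤ exp(e A)`, uniformly in `s > 0`. On `(0, b]` it gains a
-- factor `p ^ (-s)` for a kernel of order `s`, with `p` as large as desired, and this beats the
-- powers of `ω` and `λ`.

local notation:50 f " =ᵖ " g => f =ᵐ[volume.restrict (Ioi (0 : ℝ))] g

/-- The convolution `∫₀ˣ f (x - s) g s ds` of functions on the half-line. -/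
noncomputable def causalConv (f g : ℝ → ℂ) (x : ℝ) : ℂ := ∫ s in (0 : ℝ)..x, f (x - s) * g s

/-! ### Almost-everywhere statements and local integrability on the half-line -/

theorem Ioi_eq_iUnion_Ioc : Ioi (0 : ℝ) = ⋃ n : ℕ, Ioc (0 : ℝ) (n + 1) := by
  ext x
  simp only [mem_Ioi, mem_iUnion, mem_Ioc]
  refine ⟨fun hx => ?_, fun ⟨n, hn⟩ => hn.1⟩
  obtain ⟨n, hn⟩ := exists_nat_ge x
  exact ⟨n, hx, by linarith⟩

theorem ae_Ioi_of_forall_Ioc {p : ℝ → Prop}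
    (h : ∀ b : ℝ, 0 < b → ∀ᵐ x ∂(volume.restrict (Ioc 0 b)), p x) :
    ∀ᵐ x ∂(volume.restrict (Ioi (0 : ℝ))), p x := by
  rw [Ioi_eq_iUnion_Ioc, ae_restrict_iUnion_iff]
  exact fun n => h _ (by positivity)

theorem ae_Ioc_of_ae_Ioi {p : ℝ → Prop} (h : ∀ᵐ x ∂(volume.restrict (Ioi (0 : ℝ))), p x) (b : ℝ) :
    ∀ᵐ x ∂(volume.restrict (Ioc 0 b)), p x :=
  ae_restrict_of_ae_restrict_of_subset (fun _ hx => hx.1) h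

theorem eventuallyEq_pos_of_forall {f g : ℝ → ℂ} (h : ∀ x, 0 < x → f x = g x) : f =ᵖ g := by
  filter_upwards [ae_restrict_mem measurableSet_Ioi] with x hx using h x hx

theorem LocL1.congr {f g : ℝ → ℂ} (hf : LocL1 f) (h : f =ᵖ g) : LocL1 g := fun b hb =>
  (hf b hb).congr_fun_ae (ae_Ioc_of_ae_Ioi h b)

theorem LocL1.add {f g : ℝ → ℂ} (hf : LocL1 f) (hg : LocL1 g) : LocL1 (f + g) := fun b hb =>
  (hf b hb).add (hg b hb)

theorem LocL1.smul {f : ℝ → ℂ} (hf : LocL1 f) (c : ℂ) : LocL1 (c • f) := fun b hb =>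
  (hf b hb).smul c

theorem LocL1.intervalIntegrable {f : ℝ → ℂ} (hf : LocL1 f) {b : ℝ} (hb : 0 < b) :
    IntervalIntegrable f volume 0 b :=
  (intervalIntegrable_iff_integrableOn_Ioc_of_le hb.le).2 (hf b hb)

theorem LocL1.aestronglyMeasurable {f : ℝ → ℂ} (hf : LocL1 f) :
    AEStronglyMeasurable f (volume.restrict (Ioi 0)) := by
  rw [Ioi_eq_iUnion_Ioc, aestronglyMeasurable_iUnion_iff]
  exact fun n => (hf _ (by positivity)).aestronglyMeasurable

/-! ### Algebra of the half-line convolution -/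

theorem causalConv_comm (f g : ℝ → ℂ) : causalConv f g = causalConv g f := by
  funext x
  have := intervalIntegral.integral_comp_sub_left (a := 0) (b := x)
    (fun s => f s * g (x - s)) x
  simp only [sub_sub_cancel, sub_self, sub_zero] at this
  rw [causalConv, causalConv, this]
  simp only [mul_comm]

theorem causalConv_congr_right (f : ℝ → ℂ) {g g' : ℝ → ℂ} (h : g =ᵖ g') {x : ℝ} (hx : 0 < x) :
    causalConv f g x = causalConv f g' x := by
  rw [causalConv, causalConv, intervalIntegral.integral_of_le hx.le,
    intervalIntegral.integral_of_le hx.le]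
  refine integral_congr_ae ?_
  filter_upwards [ae_Ioc_of_ae_Ioi h x] with s hs
  rw [hs]

theorem causalConv_congr {f f' g g' : ℝ → ℂ} (hf : f =ᵖ f') (hg : g =ᵖ g') :
    causalConv f g =ᵖ causalConv f' g' :=
  eventuallyEq_pos_of_forall fun x hx => by
    rw [causalConv_congr_right f hg hx, causalConv_comm f, causalConv_comm f',
      causalConv_congr_right g' hf hx]

theorem causalConv_smul_right (c : ℂ) (f g : ℝ → ℂ) :
    causalConv f (c • g) = c • causalConv f g := by
  funext x
  simp only [causalConv, Pi.smul_apply, smul_eq_mul, ← intervalIntegral.integral_const_mul]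
  congr 1; funext s; ring

theorem causalConv_smul_left (c : ℂ) (f g : ℝ → ℂ) :
    causalConv (c • f) g = c • causalConv f g := by
  rw [causalConv_comm, causalConv_smul_right, causalConv_comm]

/-! ### Truncation to `(0, b]` -/

theorem LocL1.integrable_indicator {f : ℝ → ℂ} (hf : LocL1 f) {b : ℝ} (hb : 0 < b) :
    Integrable ((Ioc 0 b).indicator f) :=
  (integrable_indicator_iff measurableSet_Ioc).2 (hf b hb)

/-- For `x ≤ b` the convolution at `x` sees only values on `(0, x)`, so truncation to `(0, b]` is
harmless there. The truncations lie in `L¹(ℝ)`, which makes the theory of convolution on the line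
available. The interval is open because at `t = x` the argument `x - t = 0` is cut off. -/
theorem indicator_mul_indicator_sub (f g : ℝ → ℂ) {b x : ℝ} (hx : x ≤ b) (t : ℝ) :
    (Ioc 0 b).indicator g t * (Ioc 0 b).indicator f (x - t) =
      (Ioo 0 x).indicator (fun t => f (x - t) * g t) t := by
  by_cases h : t ∈ Ioo 0 x
  · have h1 : x - t ∈ Ioc 0 b := ⟨by linarith [h.2], by linarith [h.1]⟩
    have h2 : t ∈ Ioc 0 b := ⟨h.1, by linarith [h.2]⟩
    rw [indicator_of_mem h, indicator_of_mem h1, indicator_of_mem h2, mul_comm]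
  · rw [indicator_of_notMem h]
    by_cases h0 : 0 < t
    · rw [indicator_of_notMem (s := Ioc 0 b) (f := f), mul_zero]
      exact fun h' => h ⟨h0, by linarith [h'.1]⟩
    · rw [indicator_of_notMem (s := Ioc 0 b) (f := g), zero_mul]
      exact fun h' => h0 h'.1

theorem convolution_indicator_eq_causalConv (f g : ℝ → ℂ) {b x : ℝ} (h0 : 0 < x) (hx : x ≤ b) :
    convolution ((Ioc 0 b).indicator g) ((Ioc 0 b).indicator f)
      (ContinuousLinearMap.mul ℝ ℂ) volume x = causalConv f g x := by
  rw [convolution, causalConv, intervalIntegral.integral_of_le h0.le,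
    integral_Ioc_eq_integral_Ioo, ← integral_indicator measurableSet_Ioo]
  simp only [ContinuousLinearMap.mul_apply']
  simp_rw [indicator_mul_indicator_sub f g hx]

theorem convolution_indicator_nonpos (f g : ℝ → ℂ) {b x : ℝ} (hb : 0 < b) (hx : x ≤ 0) :
    convolution ((Ioc 0 b).indicator g) ((Ioc 0 b).indicator f)
      (ContinuousLinearMap.mul ℝ ℂ) volume x = 0 := by
  rw [convolution]
  simp only [ContinuousLinearMap.mul_apply']
  simp_rw [indicator_mul_indicator_sub f g (hx.trans hb.le), Ioo_eq_empty (not_lt.2 hx)]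
  simp

theorem indicator_causalConv (f g : ℝ → ℂ) {b x : ℝ} (hb : 0 < b) (hx : x ≤ b) :
    (Ioc 0 b).indicator (causalConv f g) x =
    convolution ((Ioc 0 b).indicator g) ((Ioc 0 b).indicator f)
      (ContinuousLinearMap.mul ℝ ℂ) volume x := by
  rcases le_or_gt x 0 with h | h
  · rw [convolution_indicator_nonpos f g hb h, indicator_of_notMem]
    exact fun h' => absurd h'.1 (not_lt.2 h)
  · rw [convolution_indicator_eq_causalConv f g h hx, indicator_of_mem (show x ∈ Ioc 0 b from ⟨h, hx⟩)]

/-! ### Integrability, distributivity and associativity of the convolution -/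

theorem LocL1.causalConv {f g : ℝ → ℂ} (hf : LocL1 f) (hg : LocL1 g) :
    LocL1 (causalConv f g) := by
  intro b hb
  refine ((hg.integrable_indicator hb).integrable_convolution (ContinuousLinearMap.mul ℝ ℂ)
    (hf.integrable_indicator hb)).integrableOn.congr_fun (s := Ioc 0 b) ?_ measurableSet_Ioc
  exact fun x hx => convolution_indicator_eq_causalConv f g hx.1 hx.2

theorem LocL1.ae_intervalIntegrable {f g : ℝ → ℂ} (hf : LocL1 f) (hg : LocL1 g) :
    ∀ᵐ x ∂(volume.restrict (Ioi (0 : ℝ))),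
      IntervalIntegrable (fun s => f (x - s) * g s) volume 0 x := by
  refine ae_Ioi_of_forall_Ioc fun b hb => ?_
  have := (hg.integrable_indicator hb).ae_convolution_exists (ContinuousLinearMap.mul ℝ ℂ)
    (hf.integrable_indicator hb)
  filter_upwards [ae_restrict_of_ae this, ae_restrict_mem measurableSet_Ioc] with x hx hxb
  rw [intervalIntegrable_iff_integrableOn_Ioc_of_le hxb.1.le,
    integrableOn_Ioc_iff_integrableOn_Ioo, ← integrable_indicator_iff measurableSet_Ioo]
  refine hx.congr (Eventually.of_forall fun t => ?_)
  exact indicator_mul_indicator_sub f g hxb.2 t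

theorem causalConv_add_right {f g h : ℝ → ℂ} (hf : LocL1 f) (hg : LocL1 g) (hh : LocL1 h) :
    causalConv f (g + h) =ᵖ causalConv f g + causalConv f h := by
  filter_upwards [hf.ae_intervalIntegrable hg, hf.ae_intervalIntegrable hh] with x h1 h2
  simp only [causalConv, Pi.add_apply, mul_add]
  exact intervalIntegral.integral_add h1 h2

theorem causalConv_add_left {f g h : ℝ → ℂ} (hf : LocL1 f) (hg : LocL1 g) (hh : LocL1 h) :
    causalConv (f + g) h =ᵖ causalConv f h + causalConv g h := by
  simpa only [causalConv_comm _ h] using causalConv_add_right hh hf hg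

/-- Fubini for the truncated functions, at the almost every `x` where the iterated convolution of
the norms exists. -/
theorem causalConv_assoc {f g h : ℝ → ℂ} (hf : LocL1 f) (hg : LocL1 g) (hh : LocL1 h) :
    causalConv (causalConv f g) h =ᵖ causalConv f (causalConv g h) := by
  refine ae_Ioi_of_forall_Ioc fun b hb => ?_
  set L := ContinuousLinearMap.mul ℝ ℂ
  set F := (Ioc 0 b).indicator f with hF
  set G := (Ioc 0 b).indicator g with hG
  set H := (Ioc 0 b).indicator h with hH
  have iF : Integrable F := hf.integrable_indicator hb
  have iG : Integrable G := hg.integrable_indicator hb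
  have iH : Integrable H := hh.integrable_indicator hb
  have e1 := iH.ae_convolution_exists L iG
  have e2 := iG.norm.ae_convolution_exists (ContinuousLinearMap.mul ℝ ℝ) iF.norm
  have e3 := iH.norm.ae_convolution_exists (ContinuousLinearMap.mul ℝ ℝ)
    (iG.norm.integrable_convolution (ContinuousLinearMap.mul ℝ ℝ) iF.norm)
  filter_upwards [ae_restrict_of_ae e3, ae_restrict_mem measurableSet_Ioc] with x hx hxb
  have key := convolution_assoc L L L L (fun x y z => mul_assoc x y z) (x₀ := x)
    iH.aestronglyMeasurable iG.aestronglyMeasurable iF.aestronglyMeasurable e1 e2 hx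
  rw [← convolution_indicator_eq_causalConv _ _ hxb.1 hxb.2,
    ← convolution_indicator_eq_causalConv _ _ hxb.1 hxb.2]
  -- Truncating the inner convolution agrees with convolving truncations only at points at most `b`;
  -- at the remaining points the outer factor vanishes.
  have h1 : convolution H ((Ioc 0 b).indicator (causalConv f g)) L volume x =
      convolution H (convolution G F L volume) L volume x := by
    rw [convolution, convolution]
    congr 1; funext t
    by_cases ht : 0 < t
    · rw [indicator_causalConv f g hb (by linarith [hxb.2])]
    · have : H t = 0 := indicator_of_notMem (fun h' => ht h'.1) _
      rw [this]; simp
  have h2 : convolution ((Ioc 0 b).indicator (causalConv g h)) F L volume x =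
      convolution (convolution H G L volume) F L volume x := by
    rw [convolution, convolution]
    congr 1; funext t
    by_cases ht : 0 < x - t
    · rw [indicator_causalConv g h hb (by linarith [hxb.2])]
    · have : F (x - t) = 0 := indicator_of_notMem (fun h' => ht h'.1) _
      rw [this]; simp
  rw [h1, h2, key]

/-! ### Convolution with a series -/

/-- `F` is a series of functions that converges absolutely on `(0, ∞)`, with locally integrable
sum of norms. -/
structure LocL1Summable (F : ℕ → ℝ → ℂ) : Prop where
  aestronglyMeasurable : ∀ n, AEStronglyMeasurable (F n) (volume.restrict (Ioi 0))
  summable : ∀ t, 0 < t → Summable fun n => ‖F n t‖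
  locL1 : LocL1 fun t => ((∑' n, ‖F n t‖ : ℝ) : ℂ)

theorem LocL1Summable.locL1_term {F : ℕ → ℝ → ℂ} (hF : LocL1Summable F) (n : ℕ) :
    LocL1 (F n) := by
  intro b hb
  refine Integrable.mono (hF.locL1 b hb) ((hF.aestronglyMeasurable n).mono_measure
    (Measure.restrict_mono Ioc_subset_Ioi_self le_rfl)) ?_
  filter_upwards [ae_restrict_mem measurableSet_Ioc] with t ht
  rw [Complex.norm_real, Real.norm_of_nonneg (tsum_nonneg fun _ => norm_nonneg _)]
  exact (hF.summable t ht.1).le_tsum n fun _ _ => norm_nonneg _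

theorem LocL1Summable.locL1_tsum {F : ℕ → ℝ → ℂ} (hF : LocL1Summable F) :
    LocL1 fun t => ∑' n, F n t := by
  intro b hb
  have hm : AEStronglyMeasurable (fun t => ∑' n, F n t) (volume.restrict (Ioc 0 b)) := by
    have h := fun n => (hF.aestronglyMeasurable n).mono_measure
      (Measure.restrict_mono Ioc_subset_Ioi_self le_rfl : volume.restrict (Ioc 0 b) ≤ _)
    refine aestronglyMeasurable_of_tendsto_ae (u := atTop)
      (f := fun N t => ∑ n ∈ Finset.range N, F n t) (fun N => ?_) ?_
    · exact Finset.aestronglyMeasurable_fun_sum _ fun n _ => h n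
    · filter_upwards [ae_restrict_mem measurableSet_Ioc] with t ht
      exact (hF.summable t ht.1).of_norm.hasSum.tendsto_sum_nat
  refine Integrable.mono (hF.locL1 b hb) hm ?_
  filter_upwards [ae_restrict_mem measurableSet_Ioc] with t ht
  rw [Complex.norm_real, Real.norm_of_nonneg (tsum_nonneg fun _ => norm_nonneg _)]
  exact norm_tsum_le_tsum_norm (hF.summable t ht.1)

/-- Dominated convergence: the sum of the norms is locally integrable, so its convolution integral
against `f` converges absolutely for almost every `x`. -/
theorem LocL1Summable.hasSum_causalConv {F : ℕ → ℝ → ℂ} (hF : LocL1Summable F) {f : ℝ → ℂ}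
    (hf : LocL1 f) : ∀ᵐ x ∂(volume.restrict (Ioi (0 : ℝ))),
      HasSum (fun n => causalConv (F n) f x) (causalConv (fun t => ∑' n, F n t) f x) := by
  have h1 : ∀ᵐ x ∂(volume.restrict (Ioi (0 : ℝ))), ∀ n,
      IntervalIntegrable (fun s => F n (x - s) * f s) volume 0 x :=
    ae_all_iff.2 fun n => (hF.locL1_term n).ae_intervalIntegrable hf
  filter_upwards [h1, hF.locL1.ae_intervalIntegrable hf, ae_restrict_mem measurableSet_Ioi]
    with x h1 h2 hx
  have hx : 0 < x := hx
  rw [intervalIntegrable_iff_integrableOn_Ioc_of_le hx.le,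
    integrableOn_Ioc_iff_integrableOn_Ioo] at h2
  simp only [causalConv, intervalIntegral.integral_of_le hx.le, integral_Ioc_eq_integral_Ioo]
  have hs : ∀ s ∈ Ioo 0 x, HasSum (fun n => ‖F n (x - s) * f s‖)
      ((∑' n, ‖F n (x - s)‖) * ‖f s‖) := fun s hs => by
    simp only [norm_mul]
    exact (hF.summable (x - s) (by linarith [hs.2])).hasSum.mul_right _
  refine hasSum_integral_of_dominated_convergence (fun n s => ‖F n (x - s) * f s‖)
    (fun n => ?_) (fun n => Eventually.of_forall fun s => le_rfl) ?_ ?_ ?_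
  · have := h1 n
    rw [intervalIntegrable_iff_integrableOn_Ioc_of_le hx.le,
      integrableOn_Ioc_iff_integrableOn_Ioo] at this
    exact this.aestronglyMeasurable
  · filter_upwards [ae_restrict_mem measurableSet_Ioo] with s h using (hs s h).summable
  · refine h2.norm.congr ?_
    filter_upwards [ae_restrict_mem measurableSet_Ioo] with s h
    rw [(hs s h).tsum_eq, norm_mul, Complex.norm_real,
      Real.norm_of_nonneg (tsum_nonneg fun _ => norm_nonneg _)]
  · filter_upwards [ae_restrict_mem measurableSet_Ioo] with s h
    exact (hF.summable (x - s) (by linarith [h.2])).of_norm.hasSum.mul_right _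

/-! ### Convolution with the constant `1` -/

theorem causalConv_one (f : ℝ → ℂ) (x : ℝ) :
    causalConv (fun _ => 1) f x = ∫ s in (0 : ℝ)..x, f s := by
  simp [causalConv]

theorem LocL1.ae_hasDerivAt_integral {f : ℝ → ℂ} (hf : LocL1 f) :
    ∀ᵐ x ∂(volume.restrict (Ioi (0 : ℝ))),
      HasDerivAt (fun x => ∫ s in (0 : ℝ)..x, f s) (f x) x := by
  refine ae_Ioi_of_forall_Ioc fun b hb => ?_
  have := (hf.intervalIntegrable hb).ae_hasDerivAt_integral
  filter_upwards [ae_restrict_of_ae this, ae_restrict_mem measurableSet_Ioc] with x hx hxb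
  rw [uIcc_of_le hb.le] at hx
  exact hx ⟨hxb.1.le, hxb.2⟩ 0 ⟨le_rfl, hb.le⟩

/-- Integration is injective: primitives are continuous, so they agree everywhere on `(0, ∞)`, and
Lebesgue differentiation recovers the functions. -/
theorem eventuallyEq_of_causalConv_one {f g : ℝ → ℂ} (hf : LocL1 f) (hg : LocL1 g)
    (h : causalConv (fun _ => 1) f =ᵖ causalConv (fun _ => 1) g) : f =ᵖ g := by
  have hall : ∀ x, 0 < x → ∫ s in (0 : ℝ)..x, f s = ∫ s in (0 : ℝ)..x, g s := by
    have hc : ∀ {u : ℝ → ℂ}, LocL1 u → ContinuousOn (fun x => ∫ s in (0 : ℝ)..x, u s) (Ioi 0) := by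
      intro u hu x hx
      have hx : 0 < x := hx
      have hb : 0 < x + 1 := by linarith
      have := intervalIntegral.continuousOn_primitive_interval (a := 0) (b := x + 1) (f := u)
        (μ := volume) (by
          rw [uIcc_of_le hb.le, integrableOn_Icc_iff_integrableOn_Ioc]; exact hu _ hb)
      rw [uIcc_of_le hb.le] at this
      exact (this.continuousAt (Icc_mem_nhds hx (by linarith))).continuousWithinAt
    have he : EqOn (fun x => ∫ s in (0 : ℝ)..x, f s) (fun x => ∫ s in (0 : ℝ)..x, g s) (Ioi 0) := by
      refine Measure.eqOn_open_of_ae_eq (μ := volume) ?_ isOpen_Ioi (hc hf) (hc hg)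
      filter_upwards [h] with x hx
      simpa only [causalConv_one] using hx
    exact fun x hx => he hx
  filter_upwards [hf.ae_hasDerivAt_integral, hg.ae_hasDerivAt_integral,
    ae_restrict_mem measurableSet_Ioi] with x h1 h2 hx
  refine h1.unique (h2.congr_of_eventuallyEq ?_)
  filter_upwards [Ioi_mem_nhds hx] with y hy using hall y hy

/-! ### The coefficients `(γ)_k / k!` -/

/-- The coefficient `(γ)_k / k!` of the binomial series of `(1 - r) ^ (-γ)`. -/
noncomputable def pochCoeff (γ : ℝ) (k : ℕ) : ℝ := (ascPochhammer ℝ k).eval γ / k.factorial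

theorem pochCoeff_zero (γ : ℝ) : pochCoeff γ 0 = 1 := by simp [pochCoeff]

theorem pochCoeff_succ (γ : ℝ) (k : ℕ) :
    pochCoeff γ (k + 1) = pochCoeff γ k * ((γ + k) / (k + 1)) := by
  rw [pochCoeff, pochCoeff, ascPochhammer_succ_eval, Nat.factorial_succ]
  push_cast
  field_simp

theorem pochCoeff_nonneg {γ : ℝ} (hγ : 0 ≤ γ) (k : ℕ) : 0 ≤ pochCoeff γ k := by
  induction k with
  | zero => simp [pochCoeff_zero]
  | succ k ih => rw [pochCoeff_succ]; positivity

/-- Compare the ratios of consecutive terms. Negative parameters do occur, in the inner and outer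
operators of the derivative. -/
theorem abs_pochCoeff_le (γ : ℝ) (k : ℕ) : |pochCoeff γ k| ≤ pochCoeff |γ| k := by
  induction k with
  | zero => simp [pochCoeff_zero]
  | succ k ih =>
    rw [pochCoeff_succ, pochCoeff_succ, abs_mul, abs_div]
    have h1 : |γ + k| ≤ |γ| + k := (abs_add_le _ _).trans (by simp)
    have h2 : |(k : ℝ) + 1| = k + 1 := abs_of_pos (by positivity)
    rw [h2]
    gcongr
    exact pochCoeff_nonneg (abs_nonneg _) _

theorem pochCoeff_eq_choose (γ : ℝ) (k : ℕ) :
    pochCoeff γ k = (-1) ^ k * Ring.choose (-γ) k := by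
  have h1 : (k.factorial : ℝ) * Ring.multichoose γ k = (ascPochhammer ℝ k).eval γ := by
    rw [← Polynomial.ascPochhammer_smeval_eq_eval, ← Ring.factorial_nsmul_multichoose_eq_ascPochhammer,
      nsmul_eq_mul]
  have h2 : pochCoeff γ k = Ring.multichoose γ k := by
    rw [pochCoeff, ← h1]; field_simp
  rw [Ring.choose_neg', h2]
  rcases Nat.even_or_odd k with h | h
  · have : (k : ℤ).negOnePow = 1 := Int.negOnePow_even _ (by exact_mod_cast h)
    simp [this, h.neg_one_pow]
  · have : (k : ℤ).negOnePow = -1 := Int.negOnePow_odd _ (by exact_mod_cast h)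
    simp [this, h.neg_one_pow]

/-- Vandermonde's identity, that is, `(1 - r) ^ (-γ) (1 - r) ^ (-δ) = (1 - r) ^ (-(γ + δ))`
coefficientwise. -/
theorem pochCoeff_add (γ δ : ℝ) (n : ℕ) :
    pochCoeff (γ + δ) n =
      ∑ ij ∈ Finset.HasAntidiagonal.antidiagonal n, pochCoeff γ ij.1 * pochCoeff δ ij.2 := by
  rw [pochCoeff_eq_choose, neg_add, Ring.add_choose_eq n (Commute.all _ _), Finset.mul_sum]
  refine Finset.sum_congr rfl fun ij h => ?_
  rw [Finset.HasAntidiagonal.mem_antidiagonal] at h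
  rw [pochCoeff_eq_choose, pochCoeff_eq_choose, ← h, pow_add]
  ring

theorem summable_abs_pochCoeff (γ : ℝ) {r : ℝ} (h0 : 0 ≤ r) (h1 : r < 1) :
    Summable fun k => |pochCoeff γ k| * r ^ k := by
  refine summable_of_ratio_norm_eventually_le (r := (1 + r) / 2) (by linarith) ?_
  -- This threshold gives `|γ| ≤ k (1 - r) / 2`, hence `(|γ| + k) r ≤ k (1 + r) / 2`.
  obtain ⟨N, hN⟩ := exists_nat_ge (2 * |γ| / (1 - r))
  filter_upwards [eventually_ge_atTop N] with k hk
  have hk' : 2 * |γ| / (1 - r) ≤ k := hN.trans (by exact_mod_cast hk)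
  rw [div_le_iff₀ (by linarith)] at hk'
  have h2 : |γ + k| ≤ |γ| + k := (abs_add_le _ _).trans (by simp)
  have h3 : |γ + k| / (k + 1) * r ≤ (1 + r) / 2 := by
    rw [div_mul_eq_mul_div, div_le_iff₀ (by positivity)]
    have : |γ + k| * r ≤ (|γ| + k) * r := by gcongr
    nlinarith [abs_nonneg γ]
  rw [pochCoeff_succ, abs_mul, abs_div, abs_of_pos (by positivity : (0 : ℝ) < k + 1), pow_succ,
    Real.norm_of_nonneg (by positivity), Real.norm_of_nonneg (by positivity)]
  calc |pochCoeff γ k| * (|γ + k| / (k + 1)) * (r ^ k * r)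
      = (|γ + k| / (k + 1) * r) * (|pochCoeff γ k| * r ^ k) := by ring
    _ ≤ _ := by gcongr

/-- The sum `∑ (γ)_k / k! r ^ k`, at `r = 1 / 2`. -/
noncomputable def pochSum (γ : ℝ) : ℝ := ∑' k, pochCoeff γ k * (1 / 2) ^ k

theorem summable_pochCoeff (γ : ℝ) : Summable fun k => pochCoeff γ k * (1 / 2 : ℝ) ^ k := by
  refine Summable.of_norm ?_
  refine (summable_abs_pochCoeff γ (r := 1 / 2) (by norm_num) (by norm_num)).congr fun k => ?_
  rw [norm_mul, Real.norm_eq_abs, Real.norm_of_nonneg (by positivity)]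

theorem pochSum_nonneg {γ : ℝ} (hγ : 0 ≤ γ) : 0 ≤ pochSum γ :=
  tsum_nonneg fun k => mul_nonneg (pochCoeff_nonneg hγ k) (by positivity)

theorem pochSum_add (γ δ : ℝ) : pochSum (γ + δ) = pochSum γ * pochSum δ := by
  rw [pochSum, pochSum, pochSum, tsum_mul_tsum_eq_tsum_sum_antidiagonal_of_summable_norm
    (summable_pochCoeff γ).norm (summable_pochCoeff δ).norm]
  refine tsum_congr fun n => ?_
  rw [pochCoeff_add, Finset.sum_mul]
  refine Finset.sum_congr rfl fun ij h => ?_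
  rw [Finset.HasAntidiagonal.mem_antidiagonal] at h
  rw [← h, pow_add]
  ring

/-- The upper parameter of the `n`-th resolvent term is `γ + n σ`; its contribution to the bounds
therefore grows only geometrically in `n`. -/
theorem pochSum_add_nat_mul (γ σ : ℝ) (n : ℕ) :
    pochSum (γ + n * σ) = pochSum γ * pochSum σ ^ n := by
  induction n with
  | zero => simp
  | succ n ih =>
    rw [show γ + ((n + 1 : ℕ) : ℝ) * σ = (γ + n * σ) + σ by push_cast; ring, pochSum_add, ih,
      pow_succ, mul_assoc]

/-! ### The Riemann-Liouville kernel -/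

/-- The Riemann-Liouville kernel `t ^ (s - 1) / Γ(s)`. -/
noncomputable def rlKernel (s t : ℝ) : ℂ := ((t ^ (s - 1) / Real.Gamma s : ℝ) : ℂ)

/-- With `B = e A`, restricting the integral for `Γ(s + 1)` to `(B, ∞)` gives `B ^ s exp(-B) ≤ s
Γ(s)`. The surplus factor `e ^ s` in `B ^ s` absorbs `s`. -/
theorem rpow_div_Gamma_le {A s : ℝ} (hA : 0 < A) (hs : 0 < s) :
    A ^ s / Real.Gamma s ≤ Real.exp (Real.exp 1 * A) := by
  set B := Real.exp 1 * A with hB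
  have hB0 : 0 < B := by positivity
  have hG : B ^ s * Real.exp (-B) ≤ Real.Gamma (s + 1) := by
    rw [Real.Gamma_eq_integral (by linarith), ← integral_exp_neg_Ioi B, ← integral_const_mul]
    have hint := Real.GammaIntegral_convergent (s := s + 1) (by linarith)
    simp only [add_sub_cancel_right] at hint ⊢
    refine (setIntegral_mono_on (g := fun x => Real.exp (-x) * x ^ s) ?_ ?_ measurableSet_Ioi
      ?_).trans (setIntegral_mono_set hint ?_ ?_)
    · exact (integrableOn_exp_neg_Ioi B).const_mul _
    · exact hint.mono_set (Ioi_subset_Ioi hB0.le)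
    · intro x hx
      rw [mul_comm]
      have : B ≤ x := le_of_lt hx
      gcongr
    · filter_upwards [ae_restrict_mem measurableSet_Ioi] with x hx
      have hx : (0 : ℝ) < x := hx
      simp only [Pi.zero_apply]
      positivity
    · exact (Ioi_subset_Ioi hB0.le).eventuallyLE
  have hΓ : 0 < Real.Gamma s := Real.Gamma_pos_of_pos hs
  rw [Real.Gamma_add_one hs.ne', hB, Real.mul_rpow (by positivity) hA.le, ← hB, Real.exp_neg] at hG
  have h1 : s ≤ Real.exp 1 ^ s := by
    rw [← Real.exp_mul, one_mul]; linarith [Real.add_one_le_exp s]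
  rw [div_le_iff₀ hΓ]
  have h2 : s * A ^ s ≤ s * (Real.exp B * Real.Gamma s) := by
    calc s * A ^ s ≤ Real.exp 1 ^ s * A ^ s := by gcongr
      _ = Real.exp B * (Real.exp 1 ^ s * A ^ s * (Real.exp B)⁻¹) := by
          field_simp
      _ ≤ Real.exp B * (s * Real.Gamma s) := by gcongr
      _ = _ := by ring
  exact le_of_mul_le_mul_left h2 hs

/-- Here `p` is free: the previous bound at `A = b p` makes `(b p) ^ s / Γ(s)` bounded in `s`,
leaving `p ^ (-s)`. The fixed power `t ^ (s₀ - 1)` keeps the singularity at `0` integrable uniformly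
in `s`. -/
theorem norm_rlKernel_le {b p s₀ s t : ℝ} (hp : 0 < p) (hs₀ : 0 < s₀) (hs : s₀ ≤ s)
    (ht : 0 < t) (htb : t ≤ b) :
    ‖rlKernel s t‖ ≤ Real.exp (Real.exp 1 * (b * p)) * b ^ (-s₀) * t ^ (s₀ - 1) * p ^ (-s) := by
  have hb : 0 < b := ht.trans_le htb
  have hΓ : 0 < Real.Gamma s := Real.Gamma_pos_of_pos (hs₀.trans_le hs)
  rw [rlKernel, Complex.norm_real, Real.norm_of_nonneg (by positivity)]
  have h1 : t ^ (s - 1) ≤ t ^ (s₀ - 1) * (b ^ s * b ^ (-s₀)) := by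
    rw [show s - 1 = (s₀ - 1) + (s - s₀) by ring, Real.rpow_add ht, ← Real.rpow_add hb,
      ← sub_eq_add_neg]
    gcongr
  have h2 := rpow_div_Gamma_le (mul_pos hb hp) (hs₀.trans_le hs)
  rw [Real.mul_rpow hb.le hp.le] at h2
  have h3 : p ^ s * p ^ (-s) = 1 := by rw [← Real.rpow_add hp]; simp
  calc t ^ (s - 1) / Real.Gamma s ≤ t ^ (s₀ - 1) * (b ^ s * b ^ (-s₀)) / Real.Gamma s := by gcongr
    _ = t ^ (s₀ - 1) * b ^ (-s₀) * (b ^ s * (p ^ s * p ^ (-s)) / Real.Gamma s) := by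
        rw [h3]; ring
    _ = t ^ (s₀ - 1) * b ^ (-s₀) * p ^ (-s) * (b ^ s * p ^ s / Real.Gamma s) := by ring
    _ ≤ t ^ (s₀ - 1) * b ^ (-s₀) * p ^ (-s) * Real.exp (Real.exp 1 * (b * p)) := by gcongr
    _ = _ := by ring

theorem measurable_rlKernel (s : ℝ) : Measurable (rlKernel s) := by
  unfold rlKernel
  fun_prop

theorem rlKernel_one (t : ℝ) : rlKernel 1 t = 1 := by simp [rlKernel]

/-- Euler's Beta integral, `B(s, t) = Γ(s) Γ(t) / Γ(s + t)`. -/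
theorem causalConv_rlKernel {s t x : ℝ} (hs : 0 < s) (ht : 0 < t) (hx : 0 < x) :
    causalConv (rlKernel s) (rlKernel t) x = rlKernel (s + t) x := by
  have h1 := Complex.betaIntegral_scaled t s hx
  have h2 := Complex.Gamma_mul_Gamma_eq_betaIntegral (s := t) (t := s) (by simpa) (by simpa)
  have hΓs : (Real.Gamma s : ℂ) ≠ 0 := by exact_mod_cast (Real.Gamma_pos_of_pos hs).ne'
  have hΓt : (Real.Gamma t : ℂ) ≠ 0 := by exact_mod_cast (Real.Gamma_pos_of_pos ht).ne'
  have hΓst : (Real.Gamma (s + t) : ℂ) ≠ 0 := by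
    exact_mod_cast (Real.Gamma_pos_of_pos (add_pos hs ht)).ne'
  rw [← Complex.ofReal_add, Complex.Gamma_ofReal, Complex.Gamma_ofReal, Complex.Gamma_ofReal,
    add_comm t s] at h2
  have h3 : causalConv (rlKernel s) (rlKernel t) x =
      (∫ y in (0 : ℝ)..x, (y : ℂ) ^ ((t : ℂ) - 1) * ((x : ℂ) - y) ^ ((s : ℂ) - 1)) /
        (Real.Gamma s * Real.Gamma t) := by
    rw [causalConv, ← intervalIntegral.integral_div]
    refine intervalIntegral.integral_congr fun y hy => ?_
    rw [uIcc_of_le hx.le] at hy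
    simp only [rlKernel]
    push_cast
    rw [Complex.ofReal_cpow hy.1, Complex.ofReal_cpow (by linarith [hy.2])]
    push_cast
    field_simp
  have h4 : ((x ^ (s + t - 1) : ℝ) : ℂ) = (x : ℂ) ^ ((t : ℂ) + s - 1) := by
    rw [Complex.ofReal_cpow hx.le]; push_cast; ring_nf
  rw [h3, h1, rlKernel]
  push_cast
  rw [h4]
  field_simp
  rw [mul_assoc, mul_comm (Complex.betaIntegral _ _), ← h2]
  ring

/-! ### The Prabhakar kernel -/

/-- The `k`-th term `(γ)_k / k! ω ^ k t ^ (ρ k + β - 1) / Γ(ρ k + β)` of the Prabhakar kernel. -/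
noncomputable def prabhakarTerm (ρ β : ℝ) (ω : ℂ) (γ : ℝ) (k : ℕ) : ℝ → ℂ :=
  ((pochCoeff γ k : ℂ) * ω ^ k) • rlKernel (ρ * k + β)

theorem prabhakarKernel_eq_tsum (ρ β : ℝ) (ω : ℂ) (γ : ℝ) {t : ℝ} (ht : 0 < t) :
    prabhakarKernel ρ β ω γ t = ∑' k, prabhakarTerm ρ β ω γ k t := by
  rw [prabhakarKernel, prabhakarE, ← tsum_mul_left]
  refine tsum_congr fun k => ?_
  have h : t ^ (ρ * k + β - 1) = t ^ (β - 1) * (t ^ ρ) ^ k := by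
    rw [← Real.rpow_natCast, ← Real.rpow_mul ht.le, ← Real.rpow_add ht]
    ring_nf
  simp only [prabhakarTerm, Pi.smul_apply, smul_eq_mul, rlKernel, h, pochCoeff]
  push_cast
  rw [mul_pow]
  ring

/-- The constant in the bounds of the kernels on `(0, b]`. -/
noncomputable def boundConst (b p s₀ : ℝ) : ℝ := Real.exp (Real.exp 1 * (b * p)) * b ^ (-s₀)

theorem norm_prabhakarTerm_le {ρ β γ b p s₀ t : ℝ} {ω : ℂ} (hρ : 0 < ρ) (hp : 0 < p)
    (hω : ‖ω‖ * p ^ (-ρ) ≤ 1 / 2) (hs₀ : 0 < s₀) (hβ : s₀ ≤ β) (ht : 0 < t) (htb : t ≤ b) (k : ℕ) :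
    ‖prabhakarTerm ρ β ω γ k t‖ ≤
      boundConst b p s₀ * t ^ (s₀ - 1) * p ^ (-β) * (pochCoeff |γ| k * (1 / 2) ^ k) := by
  have hb : 0 < b := ht.trans_le htb
  have h1 := norm_rlKernel_le (s := ρ * k + β) hp hs₀
    (hβ.trans (le_add_of_nonneg_left (by positivity))) ht htb
  have h2 : p ^ (-(ρ * k + β)) = (p ^ (-ρ)) ^ k * p ^ (-β) := by
    rw [← Real.rpow_natCast, ← Real.rpow_mul hp.le, ← Real.rpow_add hp]
    ring_nf
  rw [h2] at h1
  have h3 : 0 ≤ boundConst b p s₀ := by unfold boundConst; positivity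
  have h4 := pochCoeff_nonneg (abs_nonneg γ) k
  rw [prabhakarTerm, Pi.smul_apply, norm_smul, norm_mul, norm_pow, Complex.norm_real,
    Real.norm_eq_abs]
  calc |pochCoeff γ k| * ‖ω‖ ^ k * ‖rlKernel (ρ * k + β) t‖
      ≤ pochCoeff |γ| k * ‖ω‖ ^ k *
        (boundConst b p s₀ * t ^ (s₀ - 1) * ((p ^ (-ρ)) ^ k * p ^ (-β))) := by
        gcongr
        · exact abs_pochCoeff_le γ k
        · exact h1
    _ = boundConst b p s₀ * t ^ (s₀ - 1) * p ^ (-β) *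
        (pochCoeff |γ| k * (‖ω‖ * p ^ (-ρ)) ^ k) := by rw [mul_pow]; ring
    _ ≤ _ := by gcongr

theorem eventually_mul_rpow_neg_le (c : ℝ) {s ε : ℝ} (hs : 0 < s) (hε : 0 < ε) :
    ∀ᶠ p in atTop, c * p ^ (-s) ≤ ε := by
  have := (tendsto_rpow_neg_atTop hs).const_mul c
  rw [mul_zero] at this
  exact this.eventually (ge_mem_nhds hε)

theorem summable_norm_prabhakarTerm {ρ β : ℝ} (hρ : 0 < ρ) (hβ : 0 < β) (ω : ℂ) (γ : ℝ) {t : ℝ}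
    (ht : 0 < t) : Summable fun k => ‖prabhakarTerm ρ β ω γ k t‖ := by
  obtain ⟨p, h1, h2⟩ := ((eventually_mul_rpow_neg_le ‖ω‖ hρ one_half_pos).and
    (eventually_gt_atTop 0)).exists
  exact Summable.of_nonneg_of_le (fun _ => norm_nonneg _)
    (norm_prabhakarTerm_le hρ h2 h1 hβ le_rfl ht le_rfl)
    ((summable_pochCoeff |γ|).mul_left _)

theorem norm_prabhakarKernel_le {ρ β γ b p s₀ t : ℝ} {ω : ℂ} (hρ : 0 < ρ) (hp : 0 < p)
    (hω : ‖ω‖ * p ^ (-ρ) ≤ 1 / 2) (hs₀ : 0 < s₀) (hβ : s₀ ≤ β) (ht : 0 < t) (htb : t ≤ b) :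
    ‖prabhakarKernel ρ β ω γ t‖ ≤
      boundConst b p s₀ * t ^ (s₀ - 1) * p ^ (-β) * pochSum |γ| := by
  have h := summable_norm_prabhakarTerm hρ (hs₀.trans_le hβ) ω γ ht
  rw [prabhakarKernel_eq_tsum ρ β ω γ ht, pochSum, ← tsum_mul_left]
  exact (norm_tsum_le_tsum_norm h).trans (h.tsum_le_tsum
    (norm_prabhakarTerm_le hρ hp hω hs₀ hβ ht htb) ((summable_pochCoeff |γ|).mul_left _))

theorem LocL1Summable.of_norm_le {F : ℕ → ℝ → ℂ} {s₀ : ℝ} (hs₀ : 0 < s₀)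
    (hm : ∀ n, AEStronglyMeasurable (F n) (volume.restrict (Ioi 0)))
    (h : ∀ b, 0 < b → ∃ u : ℕ → ℝ, Summable u ∧
      ∀ n t, 0 < t → t ≤ b → ‖F n t‖ ≤ t ^ (s₀ - 1) * u n) : LocL1Summable F := by
  have hsum : ∀ t, 0 < t → Summable fun n => ‖F n t‖ := fun t ht => by
    obtain ⟨u, hu, hle⟩ := h t ht
    exact Summable.of_nonneg_of_le (fun _ => norm_nonneg _) (fun n => hle n t ht le_rfl)
      (hu.mul_left _)
  refine ⟨hm, hsum, fun b hb => ?_⟩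
  obtain ⟨u, hu, hle⟩ := h b hb
  have hi : IntegrableOn (fun t : ℝ => t ^ (s₀ - 1) * ∑' n, u n) (Ioc 0 b) :=
    ((intervalIntegrable_iff_integrableOn_Ioc_of_le hb.le).1
      (intervalIntegral.intervalIntegrable_rpow' (by linarith))).mul_const _
  have hmb := fun n => (hm n).mono_measure
    (Measure.restrict_mono Ioc_subset_Ioi_self le_rfl : volume.restrict (Ioc 0 b) ≤ _)
  refine Integrable.mono' hi ?_ ?_
  · refine aestronglyMeasurable_of_tendsto_ae (u := atTop)
      (f := fun N t => ((∑ n ∈ Finset.range N, ‖F n t‖ : ℝ) : ℂ)) (fun N => ?_) ?_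
    · exact Complex.continuous_ofReal.comp_aestronglyMeasurable
        (Finset.aestronglyMeasurable_fun_sum _ fun n _ => (hmb n).norm)
    · filter_upwards [ae_restrict_mem measurableSet_Ioc] with t ht
      exact (Complex.continuous_ofReal.tendsto _).comp (hsum t ht.1).hasSum.tendsto_sum_nat
  · filter_upwards [ae_restrict_mem measurableSet_Ioc] with t ht
    rw [Complex.norm_real, Real.norm_of_nonneg (tsum_nonneg fun _ => norm_nonneg _),
      ← tsum_mul_left]
    exact (hsum t ht.1).tsum_le_tsum (fun n => hle n t ht.1 ht.2) (hu.mul_left _)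

theorem locL1Summable_prabhakarTerm {ρ β : ℝ} (hρ : 0 < ρ) (hβ : 0 < β) (ω : ℂ) (γ : ℝ) :
    LocL1Summable (prabhakarTerm ρ β ω γ) := by
  obtain ⟨p, h1, h2⟩ := ((eventually_mul_rpow_neg_le ‖ω‖ hρ one_half_pos).and
    (eventually_gt_atTop 0)).exists
  refine LocL1Summable.of_norm_le hβ
    (fun n => ((measurable_rlKernel _).const_smul _).aestronglyMeasurable) fun b hb =>
    ⟨fun k => boundConst b p β * p ^ (-β) * (pochCoeff |γ| k * (1 / 2) ^ k),
      (summable_pochCoeff |γ|).mul_left _, fun k t ht htb => ?_⟩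
  refine (norm_prabhakarTerm_le hρ h2 h1 hβ le_rfl ht htb k).trans (le_of_eq ?_)
  ring

theorem prabhakarKernel_eventuallyEq_tsum (ρ β : ℝ) (ω : ℂ) (γ : ℝ) :
    prabhakarKernel ρ β ω γ =ᵖ fun t => ∑' k, prabhakarTerm ρ β ω γ k t :=
  eventuallyEq_pos_of_forall fun _ ht => prabhakarKernel_eq_tsum ρ β ω γ ht

theorem locL1_prabhakarKernel {ρ β : ℝ} (hρ : 0 < ρ) (hβ : 0 < β) (ω : ℂ) (γ : ℝ) :
    LocL1 (prabhakarKernel ρ β ω γ) :=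
  (locL1Summable_prabhakarTerm hρ hβ ω γ).locL1_tsum.congr
    (prabhakarKernel_eventuallyEq_tsum ρ β ω γ).symm

theorem hasSum_causalConv_prabhakarTerm {ρ β : ℝ} (hρ : 0 < ρ) (hβ : 0 < β) (ω : ℂ) (γ : ℝ)
    {f : ℝ → ℂ} (hf : LocL1 f) : ∀ᵐ x ∂(volume.restrict (Ioi (0 : ℝ))),
      HasSum (fun k => causalConv (prabhakarTerm ρ β ω γ k) f x)
        (causalConv (prabhakarKernel ρ β ω γ) f x) := by
  filter_upwards [(locL1Summable_prabhakarTerm hρ hβ ω γ).hasSum_causalConv hf,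
    causalConv_congr (prabhakarKernel_eventuallyEq_tsum ρ β ω γ) (EventuallyEq.refl _ f)] with x h e
  rwa [e]

theorem causalConv_prabhakarTerm {ρ β₁ β₂ : ℝ} (hρ : 0 < ρ) (h1 : 0 < β₁) (h2 : 0 < β₂) (ω : ℂ)
    (γ₁ γ₂ : ℝ) (i j : ℕ) {x : ℝ} (hx : 0 < x) :
    causalConv (prabhakarTerm ρ β₂ ω γ₂ j) (prabhakarTerm ρ β₁ ω γ₁ i) x =
      ((pochCoeff γ₁ i : ℂ) * pochCoeff γ₂ j * ω ^ (i + j)) *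
        rlKernel (ρ * (i + j : ℕ) + (β₁ + β₂)) x := by
  rw [prabhakarTerm, prabhakarTerm, causalConv_smul_left, causalConv_smul_right, Pi.smul_apply,
    Pi.smul_apply, causalConv_rlKernel (by positivity) (by positivity) hx, smul_eq_mul,
    smul_eq_mul, pow_add]
  push_cast
  rw [show ρ * j + β₂ + (ρ * i + β₁) = ρ * (i + j) + (β₁ + β₂) by ring]
  ring

theorem summable_prod_prabhakar {ρ β : ℝ} (hρ : 0 < ρ) (hβ : 0 < β) (ω : ℂ) (γ₁ γ₂ : ℝ) {x : ℝ}
    (hx : 0 < x) : Summable fun ij : ℕ × ℕ =>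
      ((pochCoeff γ₁ ij.1 : ℂ) * pochCoeff γ₂ ij.2 * ω ^ (ij.1 + ij.2)) *
        rlKernel (ρ * (ij.1 + ij.2 : ℕ) + β) x := by
  obtain ⟨p, hp1, hp⟩ := ((eventually_mul_rpow_neg_le ‖ω‖ hρ one_half_pos).and
    (eventually_gt_atTop 0)).exists
  have hs := ((summable_abs_pochCoeff γ₁ one_half_pos.le one_half_lt_one).mul_of_nonneg
    (summable_abs_pochCoeff γ₂ one_half_pos.le one_half_lt_one)
    (fun _ => by positivity) (fun _ => by positivity)).mul_left
      (boundConst x p β * x ^ (β - 1) * p ^ (-β))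
  refine Summable.of_norm_bounded hs fun ⟨i, j⟩ => ?_
  have h1 := norm_rlKernel_le (s := ρ * (i + j : ℕ) + β) hp hβ
    (le_add_of_nonneg_left (by positivity)) hx le_rfl
  have h2 : p ^ (-(ρ * (i + j : ℕ) + β)) = (p ^ (-ρ)) ^ (i + j) * p ^ (-β) := by
    rw [← Real.rpow_natCast, ← Real.rpow_mul hp.le, ← Real.rpow_add hp]
    ring_nf
  rw [h2] at h1
  have h3 : 0 ≤ boundConst x p β := by unfold boundConst; positivity
  simp only [norm_mul, norm_pow, Complex.norm_real, Real.norm_eq_abs]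
  calc |pochCoeff γ₁ i| * |pochCoeff γ₂ j| * ‖ω‖ ^ (i + j) * ‖rlKernel (ρ * (i + j : ℕ) + β) x‖
      ≤ |pochCoeff γ₁ i| * |pochCoeff γ₂ j| * ‖ω‖ ^ (i + j) *
        (boundConst x p β * x ^ (β - 1) * ((p ^ (-ρ)) ^ (i + j) * p ^ (-β))) := by
        gcongr; exact h1
    _ = boundConst x p β * x ^ (β - 1) * p ^ (-β) *
        (|pochCoeff γ₁ i| * |pochCoeff γ₂ j| * (‖ω‖ * p ^ (-ρ)) ^ (i + j)) := by
        rw [mul_pow]; ring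
    _ ≤ boundConst x p β * x ^ (β - 1) * p ^ (-β) *
        (|pochCoeff γ₁ i| * |pochCoeff γ₂ j| * (1 / 2) ^ (i + j)) := by gcongr
    _ = _ := by rw [pow_add]; ring

/-- Both sides are sums of one absolutely convergent double series: by rows it is the convolution,
by antidiagonals the kernel with added indices. -/
theorem causalConv_prabhakarKernel {ρ β₁ β₂ : ℝ} (hρ : 0 < ρ) (h1 : 0 < β₁) (h2 : 0 < β₂) (ω : ℂ)
    (γ₁ γ₂ : ℝ) :
    causalConv (prabhakarKernel ρ β₁ ω γ₁) (prabhakarKernel ρ β₂ ω γ₂) =ᵖ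
      prabhakarKernel ρ (β₁ + β₂) ω (γ₁ + γ₂) := by
  have hi : ∀ᵐ x ∂(volume.restrict (Ioi (0 : ℝ))), ∀ i,
      HasSum (fun j => causalConv (prabhakarTerm ρ β₂ ω γ₂ j) (prabhakarTerm ρ β₁ ω γ₁ i) x)
        (causalConv (prabhakarKernel ρ β₂ ω γ₂) (prabhakarTerm ρ β₁ ω γ₁ i) x) :=
    ae_all_iff.2 fun i => hasSum_causalConv_prabhakarTerm hρ h2 ω γ₂
      ((locL1Summable_prabhakarTerm hρ h1 ω γ₁).locL1_term i)
  filter_upwards [hi, hasSum_causalConv_prabhakarTerm hρ h1 ω γ₁ (locL1_prabhakarKernel hρ h2 ω γ₂),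
    ae_restrict_mem measurableSet_Ioi] with x hi ho hx
  have hx : 0 < x := hx
  have hs := (summable_prod_prabhakar hρ (add_pos h1 h2) ω γ₁ γ₂ hx).hasSum
  have e1 := hs.prod_fiberwise (g := fun i => causalConv (prabhakarTerm ρ β₁ ω γ₁ i)
      (prabhakarKernel ρ β₂ ω γ₂) x) fun i => by
    rw [causalConv_comm (prabhakarTerm ρ β₁ ω γ₁ i)]
    refine (hi i).congr_fun fun j => ?_
    rw [causalConv_prabhakarTerm hρ h1 h2 ω γ₁ γ₂ i j hx]
  rw [ho.unique e1, prabhakarKernel_eq_tsum _ _ _ _ hx]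
  -- On the antidiagonal `i + j = n` the Riemann-Liouville factor is constant, and Vandermonde's
  -- identity collapses the coefficients.
  have e2 := ((Finset.HasAntidiagonal.sigmaAntidiagonalEquivProd (A := ℕ)).hasSum_iff.2 hs).sigma
    (g := fun n => prabhakarTerm ρ (β₁ + β₂) ω (γ₁ + γ₂) n x) fun n => by
    have : prabhakarTerm ρ (β₁ + β₂) ω (γ₁ + γ₂) n x = ∑ ij : Finset.HasAntidiagonal.antidiagonal n,
        ((pochCoeff γ₁ ij.1.1 : ℂ) * pochCoeff γ₂ ij.1.2 * ω ^ (ij.1.1 + ij.1.2)) *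
          rlKernel (ρ * (ij.1.1 + ij.1.2 : ℕ) + (β₁ + β₂)) x := by
      rw [Finset.sum_coe_sort (Finset.HasAntidiagonal.antidiagonal n) (fun ij : ℕ × ℕ =>
        ((pochCoeff γ₁ ij.1 : ℂ) * pochCoeff γ₂ ij.2 * ω ^ (ij.1 + ij.2)) *
          rlKernel (ρ * (ij.1 + ij.2 : ℕ) + (β₁ + β₂)) x)]
      simp only [prabhakarTerm, Pi.smul_apply, smul_eq_mul, pochCoeff_add]
      push_cast
      rw [Finset.sum_mul, Finset.sum_mul]
      refine Finset.sum_congr rfl fun ij h => ?_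
      rw [Finset.HasAntidiagonal.mem_antidiagonal] at h
      rw [← h]
      push_cast
      rfl
    rw [this]
    exact hasSum_fintype _
  exact e2.tsum_eq.symm

/-! ### The resolvent kernels -/

/-- The `n`-th term `lam ^ n e^{γ + n σ}_{ρ, β + 2 n μ, ω}` of the resolvent kernel. -/
noncomputable def resolventTerm (ρ μ : ℝ) (ω lam : ℂ) (σ β γ : ℝ) (n : ℕ) : ℝ → ℂ :=
  lam ^ n • prabhakarKernel ρ (β + n * (2 * μ)) ω (γ + n * σ)

/-- The resolvent kernel `∑ lam ^ n e^{γ + n σ}_{ρ, β + 2 n μ, ω}`. -/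
noncomputable def resolventKernel (ρ μ : ℝ) (ω lam : ℂ) (σ β γ t : ℝ) : ℂ :=
  ∑' n, resolventTerm ρ μ ω lam σ β γ n t

section Resolvent

variable {ρ μ : ℝ} {ω lam : ℂ} {σ β γ : ℝ}

/-- The `n`-th term carries `(‖lam‖ · pochSum σ · p ^ (-2μ)) ^ n`; one large `p` makes this ratio
and the ratio `‖ω‖ p ^ (-ρ)` of the inner series at most `1 / 2`. -/
theorem locL1Summable_resolventTerm (hρ : 0 < ρ) (hμ : 0 < μ) (hσ : 0 ≤ σ) (hβ : 0 < β)
    (hγ : 0 ≤ γ) : LocL1Summable (resolventTerm ρ μ ω lam σ β γ) := by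
  obtain ⟨p, h1, h2, h3⟩ := ((eventually_mul_rpow_neg_le ‖ω‖ hρ one_half_pos).and
    ((eventually_gt_atTop 0).and (eventually_mul_rpow_neg_le (‖lam‖ * pochSum σ)
      (mul_pos two_pos hμ) one_half_pos))).exists
  have hβn : ∀ n : ℕ, 0 < β + n * (2 * μ) := fun n => by positivity
  have hS := pochSum_nonneg hσ
  refine LocL1Summable.of_norm_le hβ
    (fun n => ((locL1_prabhakarKernel hρ (hβn n) ω _).smul _).aestronglyMeasurable) fun b hb =>
    ⟨fun n => boundConst b p β * p ^ (-β) * pochSum γ * (1 / 2) ^ n,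
      summable_geometric_two.mul_left _, fun n t ht htb => ?_⟩
  have hle := norm_prabhakarKernel_le (γ := γ + n * σ) hρ h2 h1 hβ
    (le_add_of_nonneg_right (by positivity) : β ≤ β + n * (2 * μ)) ht htb
  have hp : p ^ (-(β + n * (2 * μ))) = p ^ (-β) * (p ^ (-(2 * μ))) ^ n := by
    rw [← Real.rpow_natCast, ← Real.rpow_mul h2.le, ← Real.rpow_add h2]
    ring_nf
  rw [abs_of_nonneg (by positivity), pochSum_add_nat_mul, hp] at hle
  have hb0 : 0 ≤ boundConst b p β := by unfold boundConst; positivity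
  have hγ0 := pochSum_nonneg hγ
  rw [resolventTerm, Pi.smul_apply, norm_smul, norm_pow]
  calc ‖lam‖ ^ n * ‖prabhakarKernel ρ (β + n * (2 * μ)) ω (γ + n * σ) t‖
      ≤ ‖lam‖ ^ n * (boundConst b p β * t ^ (β - 1) * (p ^ (-β) * (p ^ (-(2 * μ))) ^ n) *
        (pochSum γ * pochSum σ ^ n)) := by gcongr
    _ = t ^ (β - 1) * (boundConst b p β * p ^ (-β) * pochSum γ *
        (‖lam‖ * pochSum σ * p ^ (-(2 * μ))) ^ n) := by rw [mul_pow, mul_pow]; ring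
    _ ≤ t ^ (β - 1) * (boundConst b p β * p ^ (-β) * pochSum γ * (1 / 2) ^ n) := by gcongr

theorem locL1_resolventKernel (hρ : 0 < ρ) (hμ : 0 < μ) (hσ : 0 ≤ σ) (hβ : 0 < β)
    (hγ : 0 ≤ γ) : LocL1 (resolventKernel ρ μ ω lam σ β γ) :=
  (locL1Summable_resolventTerm hρ hμ hσ hβ hγ).locL1_tsum

theorem resolventKernel_eq_add (hρ : 0 < ρ) (hμ : 0 < μ) (hσ : 0 ≤ σ) (hβ : 0 < β)
    (hγ : 0 ≤ γ) {t : ℝ} (ht : 0 < t) :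
    resolventKernel ρ μ ω lam σ β γ t = prabhakarKernel ρ β ω γ t +
      lam * resolventKernel ρ μ ω lam σ (β + 2 * μ) (γ + σ) t := by
  have hs := ((locL1Summable_resolventTerm (ω := ω) (lam := lam) hρ hμ hσ hβ hγ).summable t
    ht).of_norm
  rw [resolventKernel, hs.tsum_eq_zero_add, resolventKernel, ← tsum_mul_left]
  congr 1
  · simp [resolventTerm]
  · refine tsum_congr fun n => ?_
    simp only [resolventTerm, Pi.smul_apply, smul_eq_mul]
    rw [show β + ((n + 1 : ℕ) : ℝ) * (2 * μ) = β + 2 * μ + n * (2 * μ) by push_cast; ring,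
      show γ + ((n + 1 : ℕ) : ℝ) * σ = γ + σ + n * σ by push_cast; ring, pow_succ]
    ring

/-- By the semigroup law, convolution with a Prabhakar kernel shifts the indices of every term
alike. -/
theorem causalConv_resolventKernel (hρ : 0 < ρ) (hμ : 0 < μ) (hσ : 0 ≤ σ) (hβ : 0 < β)
    (hγ : 0 ≤ γ) {β₁ : ℝ} (hβ₁ : 0 < β₁) (γ₁ : ℝ) :
    causalConv (prabhakarKernel ρ β₁ ω γ₁) (resolventKernel ρ μ ω lam σ β γ) =ᵖ
      resolventKernel ρ μ ω lam σ (β₁ + β) (γ₁ + γ) := by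
  have h1 := (locL1Summable_resolventTerm (ω := ω) (lam := lam) hρ hμ hσ hβ hγ).hasSum_causalConv
    (locL1_prabhakarKernel hρ hβ₁ ω γ₁)
  have h2 : ∀ᵐ x ∂(volume.restrict (Ioi (0 : ℝ))), ∀ n : ℕ,
      causalConv (prabhakarKernel ρ (β + n * (2 * μ)) ω (γ + n * σ))
        (prabhakarKernel ρ β₁ ω γ₁) x =
      prabhakarKernel ρ (β + n * (2 * μ) + β₁) ω (γ + n * σ + γ₁) x :=
    ae_all_iff.2 fun n => causalConv_prabhakarKernel hρ (by positivity) hβ₁ ω _ _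
  filter_upwards [h1, h2] with x h1 h2
  rw [causalConv_comm]
  change causalConv (fun t => ∑' n, resolventTerm ρ μ ω lam σ β γ n t) _ x = _
  rw [← h1.tsum_eq, resolventKernel]
  refine tsum_congr fun n => ?_
  rw [resolventTerm, causalConv_smul_left, Pi.smul_apply, h2, resolventTerm, Pi.smul_apply]
  ring_nf

end Resolvent

/-! ### The Prabhakar integral on locally integrable functions -/

/-- The index pairs of the Prabhakar integrals: `β > 0`, or `β = γ = 0` for the identity. -/
def IsPrabhakarIndex (β γ : ℝ) : Prop := 0 < β ∨ β = 0 ∧ γ = 0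

theorem prabhakarIntegral_of_pos {ρ β : ℝ} (hβ : 0 < β) (ω : ℂ) (γ : ℝ) (φ : ℝ → ℂ) :
    prabhakarIntegral ρ β ω γ φ = causalConv (prabhakarKernel ρ β ω γ) φ := by
  funext t
  rw [prabhakarIntegral, if_neg (fun h => hβ.ne' h.1), causalConv]

theorem prabhakarIntegral_zero_zero (ρ : ℝ) (ω : ℂ) (φ : ℝ → ℂ) :
    prabhakarIntegral ρ 0 ω 0 φ = φ := by
  funext t
  simp [prabhakarIntegral]

section Operators

variable {ρ β γ : ℝ} {ω : ℂ} {φ ψ : ℝ → ℂ}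

theorem LocL1.prabhakarIntegral (hρ : 0 < ρ) (hi : IsPrabhakarIndex β γ) (hφ : LocL1 φ) :
    LocL1 (prabhakarIntegral ρ β ω γ φ) := by
  rcases hi with h | ⟨rfl, rfl⟩
  · rw [prabhakarIntegral_of_pos h]
    exact (locL1_prabhakarKernel hρ h ω γ).causalConv hφ
  · rwa [prabhakarIntegral_zero_zero]

theorem prabhakarIntegral_congr (hi : IsPrabhakarIndex β γ) (h : φ =ᵖ ψ) :
    prabhakarIntegral ρ β ω γ φ =ᵖ prabhakarIntegral ρ β ω γ ψ := by
  rcases hi with hβ | ⟨rfl, rfl⟩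
  · rw [prabhakarIntegral_of_pos hβ, prabhakarIntegral_of_pos hβ]
    exact causalConv_congr (EventuallyEq.refl _ _) h
  · rwa [prabhakarIntegral_zero_zero, prabhakarIntegral_zero_zero]

theorem prabhakarIntegral_add (hρ : 0 < ρ) (hi : IsPrabhakarIndex β γ) (hφ : LocL1 φ)
    (hψ : LocL1 ψ) : prabhakarIntegral ρ β ω γ (φ + ψ) =ᵖ
      prabhakarIntegral ρ β ω γ φ + prabhakarIntegral ρ β ω γ ψ := by
  rcases hi with hβ | ⟨rfl, rfl⟩
  · simp only [prabhakarIntegral_of_pos hβ]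
    exact causalConv_add_right (locL1_prabhakarKernel hρ hβ ω γ) hφ hψ
  · simp only [prabhakarIntegral_zero_zero]
    exact EventuallyEq.refl _ _

theorem prabhakarIntegral_smul (hi : IsPrabhakarIndex β γ) (c : ℂ) (φ : ℝ → ℂ) :
    prabhakarIntegral ρ β ω γ (c • φ) = c • prabhakarIntegral ρ β ω γ φ := by
  rcases hi with hβ | ⟨rfl, rfl⟩
  · simp only [prabhakarIntegral_of_pos hβ, causalConv_smul_right]
  · simp only [prabhakarIntegral_zero_zero]

theorem prabhakarIntegral_causalConv (hρ : 0 < ρ) (hi : IsPrabhakarIndex β γ) (hφ : LocL1 φ)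
    (hψ : LocL1 ψ) : prabhakarIntegral ρ β ω γ (causalConv φ ψ) =ᵖ
      causalConv (prabhakarIntegral ρ β ω γ φ) ψ := by
  rcases hi with hβ | ⟨rfl, rfl⟩
  · simp only [prabhakarIntegral_of_pos hβ]
    exact (causalConv_assoc (locL1_prabhakarKernel hρ hβ ω γ) hφ hψ).symm
  · simp only [prabhakarIntegral_zero_zero]
    exact EventuallyEq.refl _ _

theorem prabhakarIntegral_prabhakarKernel (hρ : 0 < ρ) (hi : IsPrabhakarIndex β γ) {β₁ γ₁ : ℝ}
    (hβ₁ : 0 < β₁) : prabhakarIntegral ρ β ω γ (prabhakarKernel ρ β₁ ω γ₁) =ᵖ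
      prabhakarKernel ρ (β + β₁) ω (γ + γ₁) := by
  rcases hi with hβ | ⟨rfl, rfl⟩
  · simp only [prabhakarIntegral_of_pos hβ]
    exact causalConv_prabhakarKernel hρ hβ hβ₁ ω γ γ₁
  · simp only [prabhakarIntegral_zero_zero, zero_add]
    exact EventuallyEq.refl _ _

theorem prabhakarIntegral_resolventKernel (hρ : 0 < ρ) (hi : IsPrabhakarIndex β γ)
    {μ σ β₁ γ₁ : ℝ} {lam : ℂ} (hμ : 0 < μ) (hσ : 0 ≤ σ) (hβ₁ : 0 < β₁) (hγ₁ : 0 ≤ γ₁) :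
    prabhakarIntegral ρ β ω γ (resolventKernel ρ μ ω lam σ β₁ γ₁) =ᵖ
      resolventKernel ρ μ ω lam σ (β + β₁) (γ + γ₁) := by
  rcases hi with hβ | ⟨rfl, rfl⟩
  · simp only [prabhakarIntegral_of_pos hβ]
    exact causalConv_resolventKernel hρ hμ hσ hβ₁ hγ₁ hβ γ
  · simp only [prabhakarIntegral_zero_zero, zero_add]
    exact EventuallyEq.refl _ _

theorem prabhakarIntegral_comp (hρ : 0 < ρ) (hi : IsPrabhakarIndex β γ) {β₁ γ₁ : ℝ}
    (hi₁ : IsPrabhakarIndex β₁ γ₁) (hφ : LocL1 φ) :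
    prabhakarIntegral ρ β ω γ (prabhakarIntegral ρ β₁ ω γ₁ φ) =ᵖ
      prabhakarIntegral ρ (β + β₁) ω (γ + γ₁) φ := by
  rcases hi₁ with h₁ | ⟨rfl, rfl⟩
  · have hpos : 0 < β + β₁ := by
      rcases hi with h | ⟨h, -⟩ <;> linarith
    rw [prabhakarIntegral_of_pos h₁, prabhakarIntegral_of_pos hpos]
    exact (prabhakarIntegral_causalConv hρ hi (locL1_prabhakarKernel hρ h₁ ω γ₁) hφ).trans
      (causalConv_congr (prabhakarIntegral_prabhakarKernel hρ hi h₁) (EventuallyEq.refl _ _))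
  · simp only [prabhakarIntegral_zero_zero, add_zero]
    exact EventuallyEq.refl _ _

/-- Only `k = 0` survives, since `(0)_k = 0` for `k ≥ 1`. -/
theorem prabhakarKernel_one_zero (ρ : ℝ) (ω : ℂ) {t : ℝ} (ht : 0 < t) :
    prabhakarKernel ρ 1 ω 0 t = 1 := by
  rw [prabhakarKernel_eq_tsum _ _ _ _ ht, tsum_eq_single 0]
  · simp [prabhakarTerm, pochCoeff_zero, rlKernel_one]
  · intro k hk
    obtain ⟨k, rfl⟩ := Nat.exists_eq_succ_of_ne_zero hk
    have : pochCoeff 0 (k + 1) = 0 := by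
      rw [pochCoeff, ascPochhammer_eval_zero]; simp
    simp [prabhakarTerm, this]

theorem prabhakarIntegral_one_zero (ρ : ℝ) (ω : ℂ) (φ : ℝ → ℂ) :
    prabhakarIntegral ρ 1 ω 0 φ =ᵖ causalConv (fun _ => 1) φ := by
  rw [prabhakarIntegral_of_pos one_pos]
  exact causalConv_congr
    (eventuallyEq_pos_of_forall fun t ht => prabhakarKernel_one_zero ρ ω ht) (EventuallyEq.refl _ _)

end Operators

/-! ### Absolutely continuous complex functions -/

theorem AbsolutelyContinuousOnInterval.comp_lipschitz {X Y : Type*} [PseudoMetricSpace X]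
    [PseudoMetricSpace Y] {w : ℝ → X} {g : X → Y} {a b : ℝ}
    (hw : AbsolutelyContinuousOnInterval w a b) (hg : LipschitzWith 1 g) :
    AbsolutelyContinuousOnInterval (fun x => g (w x)) a b := by
  refine squeeze_zero (fun E => Finset.sum_nonneg fun _ _ => dist_nonneg) (fun E => ?_) hw
  exact Finset.sum_le_sum fun i _ => by simpa using hg.dist_le_mul (w (E.2 i).1) (w (E.2 i).2)

theorem AbsolutelyContinuousOnInterval.re {w : ℝ → ℂ} {a b : ℝ}
    (hw : AbsolutelyContinuousOnInterval w a b) :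
    AbsolutelyContinuousOnInterval (fun x => (w x).re) a b :=
  hw.comp_lipschitz (LipschitzWith.of_dist_le_mul fun x y => by
    simpa [dist_eq_norm, Real.norm_eq_abs] using Complex.abs_re_le_norm (x - y))

theorem AbsolutelyContinuousOnInterval.im {w : ℝ → ℂ} {a b : ℝ}
    (hw : AbsolutelyContinuousOnInterval w a b) :
    AbsolutelyContinuousOnInterval (fun x => (w x).im) a b :=
  hw.comp_lipschitz (LipschitzWith.of_dist_le_mul fun x y => by
    simpa [dist_eq_norm, Real.norm_eq_abs] using Complex.abs_im_le_norm (x - y))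

theorem intervalIntegrable_ofReal {f : ℝ → ℝ} {a b : ℝ} (hf : IntervalIntegrable f volume a b) :
    IntervalIntegrable (fun x => (f x : ℂ)) volume a b :=
  ⟨hf.1.ofReal, hf.2.ofReal⟩

theorem AbsolutelyContinuousOnInterval.ae_deriv_eq {w : ℝ → ℂ} {a b : ℝ}
    (hw : AbsolutelyContinuousOnInterval w a b) : ∀ᵐ x, x ∈ uIcc a b →
      deriv w x = ((deriv (fun x => (w x).re) x : ℝ) : ℂ) +
        ((deriv (fun x => (w x).im) x : ℝ) : ℂ) * Complex.I := by
  filter_upwards [hw.re.ae_differentiableAt, hw.im.ae_differentiableAt] with x h1 h2 hx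
  have h := (h1 hx).hasDerivAt.ofReal_comp.add ((h2 hx).hasDerivAt.ofReal_comp.mul_const Complex.I)
  rw [← h.deriv]
  congr 1
  funext y
  exact (Complex.re_add_im (w y)).symm

theorem AbsolutelyContinuousOnInterval.intervalIntegrable_deriv_complex {w : ℝ → ℂ} {a b : ℝ}
    (hw : AbsolutelyContinuousOnInterval w a b) : IntervalIntegrable (deriv w) volume a b := by
  have h : IntervalIntegrable (fun x => ((deriv (fun x => (w x).re) x : ℝ) : ℂ) +
        ((deriv (fun x => (w x).im) x : ℝ) : ℂ) * Complex.I) volume a b :=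
    (intervalIntegrable_ofReal hw.re.intervalIntegrable_deriv).add ((intervalIntegrable_ofReal hw.im.intervalIntegrable_deriv).mul_const Complex.I)
  refine h.congr_ae ?_
  filter_upwards [ae_restrict_of_ae hw.ae_deriv_eq, ae_restrict_mem measurableSet_uIoc]
    with x h1 h2
  exact (h1 (uIoc_subset_uIcc h2)).symm

theorem AbsolutelyContinuousOnInterval.integral_deriv_complex {w : ℝ → ℂ} {a b : ℝ}
    (hw : AbsolutelyContinuousOnInterval w a b) : ∫ x in a..b, deriv w x = w b - w a := by
  have h : ∫ x in a..b, deriv w x = ∫ x in a..b, (((deriv (fun x => (w x).re) x : ℝ) : ℂ) +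
        ((deriv (fun x => (w x).im) x : ℝ) : ℂ) * Complex.I) := by
    refine intervalIntegral.integral_congr_ae ?_
    filter_upwards [hw.ae_deriv_eq] with x hx h using hx (uIoc_subset_uIcc h)
  rw [h, intervalIntegral.integral_add (intervalIntegrable_ofReal hw.re.intervalIntegrable_deriv)
    ((intervalIntegrable_ofReal hw.im.intervalIntegrable_deriv).mul_const Complex.I), intervalIntegral.integral_mul_const,
    intervalIntegral.integral_ofReal, intervalIntegral.integral_ofReal,
    hw.re.integral_deriv_eq_sub, hw.im.integral_deriv_eq_sub]
  apply Complex.ext <;> simp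

/-- Increments of the primitive of `h` are dominated by those of the primitive of `‖h‖`. -/
theorem LocL1.absolutelyContinuousOnInterval_primitive {h : ℝ → ℂ} (hh : LocL1 h) (c : ℂ) {b : ℝ}
    (hb : 0 < b) : AbsolutelyContinuousOnInterval (fun x => c + ∫ s in (0 : ℝ)..x, h s) 0 b := by
  have hi := hh.intervalIntegrable hb
  have hac := hi.norm.absolutelyContinuousOnInterval_intervalIntegral (c := 0) left_mem_uIcc
  refine squeeze_zero' (Eventually.of_forall fun E => Finset.sum_nonneg fun _ _ => dist_nonneg)
    ?_ hac
  filter_upwards [mem_inf_of_right (mem_principal_self _)] with E hE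
  refine Finset.sum_le_sum fun i hI => ?_
  obtain ⟨h1, h2⟩ := hE.1 i hI
  have hsub : ∀ {u v : ℝ}, u ∈ uIcc 0 b → v ∈ uIcc 0 b → IntervalIntegrable h volume u v :=
    fun hu hv => hi.mono_set (uIcc_subset_uIcc hu hv)
  have h0 : (0 : ℝ) ∈ uIcc 0 b := left_mem_uIcc
  rw [dist_add_left, dist_eq_norm, dist_eq_norm,
    intervalIntegral.integral_interval_sub_left (hsub h0 h1) (hsub h0 h2),
    intervalIntegral.integral_interval_sub_left (hsub h0 h1).norm (hsub h0 h2).norm]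
  exact intervalIntegral.norm_integral_le_abs_integral_norm

/-! ### The Volterra equation -/

section Volterra

variable {ρ μ : ℝ} {ω lam : ℂ} {σ : ℝ}

/-- The solution of the Volterra equation `y = F + lam e^σ_{ρ,2μ,ω} * y`. -/
theorem eventuallyEq_of_volterra (hρ : 0 < ρ) (hμ : 0 < μ) (hσ : 0 ≤ σ) {y F : ℝ → ℂ}
    (hy : LocL1 y) (hF : LocL1 F)
    (h : y =ᵖ F + lam • causalConv (prabhakarKernel ρ (2 * μ) ω σ) y) :
    y =ᵖ F + lam • causalConv (resolventKernel ρ μ ω lam σ (2 * μ) σ) F := by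
  have h2μ : 0 < 2 * μ := by positivity
  set k := prabhakarKernel ρ (2 * μ) ω σ with hk
  set T := resolventKernel ρ μ ω lam σ (2 * μ) σ with hT
  have lk : LocL1 k := locL1_prabhakarKernel hρ h2μ ω σ
  have lT : LocL1 T := locL1_resolventKernel hρ hμ hσ h2μ hσ
  have hTk : T =ᵖ k + lam • causalConv T k := by
    have h1 := causalConv_resolventKernel (ω := ω) (lam := lam) hρ hμ hσ h2μ hσ h2μ σ
    filter_upwards [h1, ae_restrict_mem measurableSet_Ioi] with t h1 ht
    rw [causalConv_comm] at h1
    rw [Pi.add_apply, Pi.smul_apply, h1, hT, resolventKernel_eq_add hρ hμ hσ h2μ hσ ht, smul_eq_mul]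
  -- Expanding `T * y` through the equation for `y` and through `T = k + lam T * k` and comparing
  -- gives `T * F = k * y`.
  have e1 : causalConv T y =ᵖ causalConv T F + lam • causalConv T (causalConv k y) := by
    have := causalConv_add_right lT hF ((lk.causalConv hy).smul lam)
    rw [causalConv_smul_right] at this
    exact (causalConv_congr (EventuallyEq.refl _ T) h).trans this
  have e2 : causalConv T y =ᵖ causalConv k y + lam • causalConv (causalConv T k) y := by
    have := causalConv_add_left lk ((lT.causalConv lk).smul lam) hy
    rw [causalConv_smul_left] at this
    exact (causalConv_congr hTk (EventuallyEq.refl _ y)).trans this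
  filter_upwards [h, e1, e2, causalConv_assoc lT lk hy] with t h e1 e2 e3
  simp only [Pi.add_apply, Pi.smul_apply, smul_eq_mul] at h e1 e2 e3 ⊢
  rw [e3] at e2
  linear_combination h + lam * (e1 - e2)

variable {β γ γ' : ℝ} {f : ℝ → ℂ}

/-- The solution of the Volterra equation with the right-hand side
`c e^{γ'}_{ρ,β,ω} + 𝐄^γ_{ρ,μ,ω,0+} f`. -/
theorem eventuallyEq_resolvent_of_volterra (hρ : 0 < ρ) (hμ : 0 < μ) (hσ : 0 ≤ σ) (hβ : 0 < β)
    (hγ' : 0 ≤ γ') (hγ : 0 ≤ γ) (c : ℂ) (hf : LocL1 f) {y : ℝ → ℂ} (hy : LocL1 y)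
    (h : y =ᵖ c • prabhakarKernel ρ β ω γ' + causalConv (prabhakarKernel ρ μ ω γ) f +
      lam • causalConv (prabhakarKernel ρ (2 * μ) ω σ) y) :
    y =ᵖ c • resolventKernel ρ μ ω lam σ β γ' +
      causalConv (resolventKernel ρ μ ω lam σ μ γ) f := by
  have h2μ : 0 < 2 * μ := by positivity
  have lkβ := locL1_prabhakarKernel hρ hβ ω γ'
  have lkμ := locL1_prabhakarKernel hρ hμ ω γ
  set T := resolventKernel ρ μ ω lam σ (2 * μ) σ with hT
  have lT : LocL1 T := locL1_resolventKernel hρ hμ hσ h2μ hσ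
  have lT3 : LocL1 (resolventKernel ρ μ ω lam σ (μ + 2 * μ) (γ + σ)) :=
    locL1_resolventKernel hρ hμ hσ (by positivity) (by positivity)
  have e0 := eventuallyEq_of_volterra hρ hμ hσ hy ((lkβ.smul c).add (lkμ.causalConv hf)) h
  have e1 := causalConv_add_right lT (lkβ.smul c) (lkμ.causalConv hf)
  rw [causalConv_smul_right, causalConv_comm T (prabhakarKernel _ _ _ _)] at e1
  have e2 := causalConv_resolventKernel (ω := ω) (lam := lam) hρ hμ hσ h2μ hσ hβ γ'
  have e3 : causalConv T (causalConv (prabhakarKernel ρ μ ω γ) f) =ᵖ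
      causalConv (resolventKernel ρ μ ω lam σ (μ + 2 * μ) (γ + σ)) f := by
    refine (causalConv_assoc lT lkμ hf).symm.trans (causalConv_congr ?_ (EventuallyEq.refl _ f))
    rw [causalConv_comm]
    exact causalConv_resolventKernel hρ hμ hσ h2μ hσ hμ γ
  have e4 : causalConv (resolventKernel ρ μ ω lam σ μ γ) f =ᵖ
      causalConv (prabhakarKernel ρ μ ω γ) f +
        lam • causalConv (resolventKernel ρ μ ω lam σ (μ + 2 * μ) (γ + σ)) f := by
    have := causalConv_add_left lkμ (lT3.smul lam) hf
    rw [causalConv_smul_left] at this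
    refine (causalConv_congr ?_ (EventuallyEq.refl _ f)).trans this
    exact eventuallyEq_pos_of_forall fun t ht => resolventKernel_eq_add hρ hμ hσ hμ hγ ht
  -- The forcing terms are exactly the zeroth terms of the two resolvent series, and convolution
  -- with `lam T` supplies the rest.
  filter_upwards [e0, e1, e2, e3, e4, ae_restrict_mem measurableSet_Ioi] with t e0 e1 e2 e3 e4 ht
  simp only [Pi.add_apply, Pi.smul_apply, smul_eq_mul] at e0 e1 e2 e3 e4 ⊢
  rw [e0, e1, e2, e3, e4, resolventKernel_eq_add hρ hμ hσ hβ hγ' ht]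
  ring

/-- The function `c ∑ lam ^ n e^{γ + n σ}_{ρ,μ(2n+1),ω} + (∑ lam ^ n e^{γ + n σ}_{ρ,μ(2n+1),ω}) * g`
solves the Volterra equation. -/
theorem volterra_resolvent (hρ : 0 < ρ) (hμ : 0 < μ) (hσ : 0 ≤ σ) (hγ : 0 ≤ γ) (c : ℂ)
    {g Z : ℝ → ℂ} (hg : LocL1 g)
    (hZ : Z = c • resolventKernel ρ μ ω lam σ μ γ +
      causalConv (resolventKernel ρ μ ω lam σ μ γ) g) :
    Z =ᵖ c • prabhakarKernel ρ μ ω γ + causalConv (prabhakarKernel ρ μ ω γ) g +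
      lam • causalConv (prabhakarKernel ρ (2 * μ) ω σ) Z := by
  have h2μ : 0 < 2 * μ := by positivity
  have lk := locL1_prabhakarKernel hρ h2μ ω σ
  have lkμ := locL1_prabhakarKernel hρ hμ ω γ
  set T := resolventKernel ρ μ ω lam σ μ γ with hT
  have lT : LocL1 T := locL1_resolventKernel hρ hμ hσ hμ hγ
  have lT3 : LocL1 (resolventKernel ρ μ ω lam σ (2 * μ + μ) (σ + γ)) :=
    locL1_resolventKernel hρ hμ hσ (by positivity) (by positivity)
  have e1 := causalConv_add_right lk (lT.smul c) (lT.causalConv hg)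
  rw [causalConv_smul_right] at e1
  have e2 := causalConv_resolventKernel (ω := ω) (lam := lam) hρ hμ hσ hμ hγ h2μ σ
  have e3 := (causalConv_assoc lk lT hg).symm.trans (causalConv_congr e2 (EventuallyEq.refl _ g))
  have e4 : causalConv T g =ᵖ causalConv (prabhakarKernel ρ μ ω γ) g +
        lam • causalConv (resolventKernel ρ μ ω lam σ (2 * μ + μ) (σ + γ)) g := by
    have := causalConv_add_left lkμ (lT3.smul lam) hg
    rw [causalConv_smul_left] at this
    refine (causalConv_congr ?_ (EventuallyEq.refl _ g)).trans this
    refine eventuallyEq_pos_of_forall fun t ht => ?_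
    rw [hT, resolventKernel_eq_add hρ hμ hσ hμ hγ ht, add_comm (2 * μ), add_comm σ]
    rfl
  filter_upwards [e1, e2, e3, e4, ae_restrict_mem measurableSet_Ioi] with t e1 e2 e3 e4 ht
  have e5 := resolventKernel_eq_add (ω := ω) (lam := lam) hρ hμ hσ hμ hγ ht
  rw [add_comm μ, add_comm γ, ← hT] at e5
  rw [hZ]
  simp only [Pi.add_apply, Pi.smul_apply, smul_eq_mul] at e1 e2 e3 e4 ⊢
  rw [e1, e2, e3, e4, e5]
  ring

end Volterra

/-! ### The Cauchy problem -/

section Cauchy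

variable {ρ μ ν γ δ K : ℝ} {ω lam : ℂ} {f : ℝ → ℂ}

/-- At `ν = 0` both indices vanish, so the degenerate case is exactly the identity convention. -/
theorem isPrabhakarIndex_outer (hμ : μ ∈ Ioo (0 : ℝ) 1) (hν : ν ∈ Icc (0 : ℝ) 1) (γ : ℝ) :
    IsPrabhakarIndex (ν * (1 - μ)) (-(γ * ν)) := by
  have h1 : 0 < 1 - μ := by linarith [hμ.2]
  rcases hν.1.eq_or_lt with rfl | h
  · exact Or.inr (by simp)
  · exact Or.inl (mul_pos h h1)

theorem isPrabhakarIndex_inner (hμ : μ ∈ Ioo (0 : ℝ) 1) (hν : ν ∈ Icc (0 : ℝ) 1) (γ : ℝ) :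
    IsPrabhakarIndex ((1 - ν) * (1 - μ)) (-(γ * (1 - ν))) :=
  isPrabhakarIndex_outer hμ ⟨by linarith [hν.2], by linarith [hν.1]⟩ γ

theorem cauchyFormula_eventuallyEq (hρ : 0 < ρ) (hμ : μ ∈ Ioo (0 : ℝ) 1)
    (hγ : 0 ≤ γ) (hδ : 0 ≤ δ) (hf : LocL1 f) :
    cauchyFormula ρ ω γ μ ν δ lam K f =ᵖ
      (K : ℂ) • resolventKernel ρ μ ω lam (δ + γ) (ν * (1 - μ) + μ) (γ - γ * ν) +
        causalConv (resolventKernel ρ μ ω lam (δ + γ) μ γ) f := by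
  have h := (locL1Summable_resolventTerm (ω := ω) (lam := lam) hρ hμ.1 (add_nonneg hδ hγ)
    hμ.1 hγ).hasSum_causalConv hf
  filter_upwards [h] with x h
  simp only [Pi.add_apply, Pi.smul_apply, smul_eq_mul, cauchyFormula]
  congr 1
  · rw [resolventKernel]
    congr 1
    refine tsum_congr fun n => ?_
    simp only [resolventTerm, Pi.smul_apply, smul_eq_mul, prabhakarKernel]
    rw [show ν * (1 - μ) + μ * (2 * n + 1) = ν * (1 - μ) + μ + n * (2 * μ) by ring, mul_assoc]
  · refine Eq.trans (tsum_congr fun n => ?_) h.tsum_eq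
    have hn : 0 < (2 * n + 1) * μ := mul_pos (by positivity) hμ.1
    rw [prabhakarIntegral_of_pos hn, resolventTerm, causalConv_smul_left, Pi.smul_apply, smul_eq_mul,
      show (2 * n + 1) * μ = μ + n * (2 * μ) by ring]

/-- The inner operator applied to `y` is `K + ∫ h` exactly if
`y = K e^{γ-γν}_{ρ,ν(1-μ)+μ,ω} + 𝐄^{γ-γν}_{ρ,ν(1-μ)+μ,ω,0+} h`. -/
theorem inner_eq_primitive_iff (hρ : 0 < ρ) (hμ : μ ∈ Ioo (0 : ℝ) 1) (hν : ν ∈ Icc (0 : ℝ) 1)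
    (c : ℂ) {y h : ℝ → ℂ} (hy : LocL1 y) (hh : LocL1 h) :
    ((prabhakarIntegral ρ ((1 - ν) * (1 - μ)) ω (-(γ * (1 - ν))) y =ᵖ
      fun x => c + ∫ s in (0 : ℝ)..x, h s) ↔
    y =ᵖ c • prabhakarKernel ρ (ν * (1 - μ) + μ) ω (γ - γ * ν) +
      prabhakarIntegral ρ (ν * (1 - μ) + μ) ω (γ - γ * ν) h) := by
  have hi := isPrabhakarIndex_inner hμ hν γ
  have hpos : 0 < ν * (1 - μ) + μ :=
    add_pos_of_nonneg_of_pos (mul_nonneg hν.1 (by linarith [hμ.2])) hμ.1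
  have hj : IsPrabhakarIndex (ν * (1 - μ) + μ) (γ - γ * ν) := Or.inl hpos
  have h1 : IsPrabhakarIndex 1 0 := Or.inl one_pos
  have lk := locL1_prabhakarKernel hρ hpos ω (γ - γ * ν)
  have l1 := locL1_prabhakarKernel hρ one_pos ω 0
  have i1 : (1 - ν) * (1 - μ) + (ν * (1 - μ) + μ) = 1 := by ring
  have i2 : -(γ * (1 - ν)) + (γ - γ * ν) = 0 := by ring
  have hw : (fun x => c + ∫ s in (0 : ℝ)..x, h s) =ᵖ
      c • prabhakarKernel ρ 1 ω 0 + prabhakarIntegral ρ 1 ω 0 h := by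
    filter_upwards [prabhakarIntegral_one_zero ρ ω h, ae_restrict_mem measurableSet_Ioi] with x e hx
    rw [Pi.add_apply, e, causalConv_one, Pi.smul_apply, prabhakarKernel_one_zero ρ ω hx]
    simp
  constructor
  · intro e
    have lR : LocL1 (c • prabhakarKernel ρ (ν * (1 - μ) + μ) ω (γ - γ * ν) +
        prabhakarIntegral ρ (ν * (1 - μ) + μ) ω (γ - γ * ν) h) :=
      (lk.smul c).add (hh.prabhakarIntegral (ω := ω) hρ hj)
    -- Integration factors as the complementary operator after the inner one, so it suffices to
    -- compare the primitives of both sides.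
    refine eventuallyEq_of_causalConv_one hy lR ?_
    refine (prabhakarIntegral_one_zero ρ ω y).symm.trans
      (EventuallyEq.trans ?_ (prabhakarIntegral_one_zero ρ ω _))
    have a1 := prabhakarIntegral_comp (ω := ω) hρ hj hi hy
    rw [add_comm _ ((1 - ν) * (1 - μ)), add_comm _ (-(γ * (1 - ν))), i1, i2] at a1
    have a2 := prabhakarIntegral_congr (ρ := ρ) (ω := ω) hj (e.trans hw)
    have a3 := prabhakarIntegral_add (ω := ω) hρ hj (l1.smul c) (hh.prabhakarIntegral (ω := ω) hρ h1)
    rw [prabhakarIntegral_smul hj] at a3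
    have a4 := prabhakarIntegral_prabhakarKernel (ω := ω) (γ₁ := 0) hρ hj one_pos
    have a5 := prabhakarIntegral_comp (ω := ω) hρ hj h1 hh
    have a6 := prabhakarIntegral_add (ω := ω) hρ h1 (lk.smul c) (hh.prabhakarIntegral (ω := ω) hρ hj)
    rw [prabhakarIntegral_smul h1] at a6
    have a7 := prabhakarIntegral_prabhakarKernel (ω := ω) (γ₁ := γ - γ * ν) hρ h1 hpos
    have a8 := prabhakarIntegral_comp (ω := ω) hρ h1 hj hh
    rw [add_comm 1 (_ + _), add_comm 0] at a7 a8
    filter_upwards [a1, a2, a3, a4, a5, a6, a7, a8] with x a1 a2 a3 a4 a5 a6 a7 a8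
    rw [← a1, a2, a3, a6, Pi.add_apply, Pi.add_apply, Pi.smul_apply, Pi.smul_apply, a4, a5, a7, a8]
  · intro e
    have a1 := prabhakarIntegral_congr (ρ := ρ) (ω := ω) hi e
    have a2 := prabhakarIntegral_add (ω := ω) hρ hi (lk.smul c) (hh.prabhakarIntegral (ω := ω) hρ hj)
    rw [prabhakarIntegral_smul hi] at a2
    have a3 := prabhakarIntegral_prabhakarKernel (ω := ω) (γ₁ := γ - γ * ν) hρ hi hpos
    have a4 := prabhakarIntegral_comp (ω := ω) hρ hi hj hh
    rw [i1, i2] at a3 a4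
    filter_upwards [hw, a1, a2, a3, a4] with x hw a1 a2 a3 a4
    rw [hw, a1, a2, Pi.add_apply, Pi.add_apply, Pi.smul_apply, Pi.smul_apply, a3, a4]

theorem IsACRepresentative.locL1_deriv {F w : ℝ → ℂ} (h : IsACRepresentative F w) :
    LocL1 (deriv w) := fun b hb =>
  (intervalIntegrable_iff_integrableOn_Ioc_of_le hb.le).1
    (h.1 b hb).intervalIntegrable_deriv_complex

theorem IsACRepresentative.eq_primitive {F w : ℝ → ℂ} (h : IsACRepresentative F w) {c : ℂ}
    (hc : Tendsto w (𝓝[>] 0) (𝓝 c)) {x : ℝ} (hx : 0 < x) :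
    w x = c + ∫ s in (0 : ℝ)..x, deriv w s := by
  have h0 : w 0 = c := by
    have hcont := (h.1 1 one_pos).continuousOn 0 left_mem_uIcc
    rw [uIcc_of_le zero_le_one] at hcont
    have := hcont.tendsto.mono_left (nhdsWithin_mono (0 : ℝ) Ioc_subset_Icc_self)
    rw [nhdsWithin_Ioc_eq_nhdsGT one_pos] at this
    exact tendsto_nhds_unique this hc
  rw [(h.1 x hx).integral_deriv_complex, h0]
  ring

/-- A solution `y` of the Cauchy problem, with derivative `h` of its absolutely continuous
representative, is `K e^{γ-γν}_{ρ,ν(1-μ)+μ,ω} + 𝐄^{γ-γν}_{ρ,ν(1-μ)+μ,ω,0+} h`. -/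
theorem IsCauchySolution.exists_density (hρ : 0 < ρ) (hμ : μ ∈ Ioo (0 : ℝ) 1)
    (hν : ν ∈ Icc (0 : ℝ) 1) {y : ℝ → ℂ} (hs : IsCauchySolution ρ ω γ μ ν δ lam K f y) :
    LocL1 y ∧ ∃ h, LocL1 h ∧
      (lam • prabhakarIntegral ρ μ ω δ y + f =ᵖ
        prabhakarIntegral ρ (ν * (1 - μ)) ω (-(γ * ν)) h) ∧
      y =ᵖ (K : ℂ) • prabhakarKernel ρ (ν * (1 - μ) + μ) ω (γ - γ * ν) +
        prabhakarIntegral ρ (ν * (1 - μ) + μ) ω (γ - γ * ν) h := by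
  obtain ⟨w, ⟨hy, hrep, hD⟩, hK⟩ := hs
  refine ⟨hy, deriv w, hrep.locL1_deriv, hD, ?_⟩
  refine (inner_eq_primitive_iff hρ hμ hν _ hy hrep.locL1_deriv).1 ?_
  exact hrep.2.symm.trans (eventuallyEq_pos_of_forall fun x hx => hrep.eq_primitive hK hx)

/-- The converse of `IsCauchySolution.exists_density`: the representative is `K + ∫ h`, whose
derivative is `h` almost everywhere. -/
theorem IsCauchySolution.of_density (hρ : 0 < ρ) (hμ : μ ∈ Ioo (0 : ℝ) 1)
    (hν : ν ∈ Icc (0 : ℝ) 1) {y h : ℝ → ℂ} (hy : LocL1 y) (hh : LocL1 h)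
    (hA : lam • prabhakarIntegral ρ μ ω δ y + f =ᵖ
      prabhakarIntegral ρ (ν * (1 - μ)) ω (-(γ * ν)) h)
    (hyh : y =ᵖ (K : ℂ) • prabhakarKernel ρ (ν * (1 - μ) + μ) ω (γ - γ * ν) +
      prabhakarIntegral ρ (ν * (1 - μ) + μ) ω (γ - γ * ν) h) :
    IsCauchySolution ρ ω γ μ ν δ lam K f y := by
  have hAC := fun b hb => hh.absolutelyContinuousOnInterval_primitive (K : ℂ) (b := b) hb
  have hderiv : deriv (fun x => (K : ℂ) + ∫ s in (0 : ℝ)..x, h s) =ᵖ h := by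
    filter_upwards [hh.ae_hasDerivAt_integral] with x hx using (hx.const_add _).deriv
  refine ⟨fun x => K + ∫ s in (0 : ℝ)..x, h s, ⟨hy, ⟨hAC, ?_⟩, ?_⟩, ?_⟩
  · exact ((inner_eq_primitive_iff hρ hμ hν _ hy hh).2 hyh).symm
  · exact hA.trans (prabhakarIntegral_congr (isPrabhakarIndex_outer hμ hν γ) hderiv.symm)
  · have hcont := (hAC 1 one_pos).continuousOn 0 left_mem_uIcc
    rw [uIcc_of_le zero_le_one] at hcont
    have := hcont.tendsto.mono_left (nhdsWithin_mono (0 : ℝ) Ioc_subset_Icc_self)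
    rw [nhdsWithin_Ioc_eq_nhdsGT one_pos] at this
    simpa using this

/-- Applying `E(μ,γ)` to the equation turns `A h` into the `h`-term of the representation of `y`;
eliminating `h` leaves the Volterra equation. -/
theorem IsCauchySolution.eventuallyEq_cauchyFormula (hρ : 0 < ρ) (hμ : μ ∈ Ioo (0 : ℝ) 1)
    (hν : ν ∈ Icc (0 : ℝ) 1) (hγ : 0 ≤ γ) (hδ : 0 ≤ δ) (hf : LocL1 f) {y : ℝ → ℂ}
    (hs : IsCauchySolution ρ ω γ μ ν δ lam K f y) :
    y =ᵖ cauchyFormula ρ ω γ μ ν δ lam K f := by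
  obtain ⟨hy, h, hh, hA, hyh⟩ := hs.exists_density hρ hμ hν
  have hpos : 0 < ν * (1 - μ) + μ :=
    add_pos_of_nonneg_of_pos (mul_nonneg hν.1 (by linarith [hμ.2])) hμ.1
  have hiA := isPrabhakarIndex_outer hμ hν γ
  have iμ : ∀ γ', IsPrabhakarIndex μ γ' := fun _ => Or.inl hμ.1
  refine EventuallyEq.trans ?_ (cauchyFormula_eventuallyEq hρ hμ hγ hδ hf).symm
  refine eventuallyEq_resolvent_of_volterra hρ hμ.1 (add_nonneg hδ hγ) hpos
    (by nlinarith [hν.2]) hγ K hf hy ?_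
  have a1 := prabhakarIntegral_comp (ω := ω) hρ (iμ γ) hiA hh
  rw [add_comm μ, ← sub_eq_add_neg] at a1
  have a2 := prabhakarIntegral_congr (ρ := ρ) (ω := ω) (iμ γ) hA
  have a3 := prabhakarIntegral_add (ω := ω) hρ (iμ γ) ((hy.prabhakarIntegral (ω := ω) hρ (iμ δ)).smul lam) hf
  rw [prabhakarIntegral_smul (iμ γ)] at a3
  have a4 := prabhakarIntegral_comp (ω := ω) hρ (iμ γ) (iμ δ) hy
  rw [← two_mul, add_comm γ, prabhakarIntegral_of_pos (mul_pos two_pos hμ.1)] at a4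
  filter_upwards [hyh, a1, a2, a3, a4] with x e a1 a2 a3 a4
  rw [e, Pi.add_apply, ← a1, ← a2, a3, prabhakarIntegral_of_pos hμ.1 ω γ f]
  simp only [Pi.add_apply, Pi.smul_apply, a4]
  ring

theorem exists_range_of_isCauchySolution (hρ : 0 < ρ) (hμ : μ ∈ Ioo (0 : ℝ) 1)
    (hν : ν ∈ Icc (0 : ℝ) 1) {y : ℝ → ℂ} (hs : IsCauchySolution ρ ω γ μ ν δ lam K f y) :
    ∃ g : ℝ → ℂ, LocL1 g ∧
      f =ᵖ prabhakarIntegral ρ (ν * (1 - μ)) ω (-(γ * ν)) g := by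
  obtain ⟨hy, h, hh, hA, hyh⟩ := hs.exists_density hρ hμ hν
  have hiA := isPrabhakarIndex_outer hμ hν γ
  have iμ : ∀ γ', IsPrabhakarIndex μ γ' := fun _ => Or.inl hμ.1
  have lk := locL1_prabhakarKernel hρ hμ.1 ω γ
  set Z := (K : ℂ) • prabhakarKernel ρ μ ω γ + prabhakarIntegral ρ μ ω γ h with hZ
  have lZ : LocL1 Z := (lk.smul _).add (hh.prabhakarIntegral (ω := ω) hρ (iμ γ))
  have hyZ : y =ᵖ prabhakarIntegral ρ (ν * (1 - μ)) ω (-(γ * ν)) Z := by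
    have a1 := prabhakarIntegral_add (ω := ω) hρ hiA (lk.smul (K : ℂ))
      (hh.prabhakarIntegral (ω := ω) hρ (iμ γ))
    rw [prabhakarIntegral_smul hiA] at a1
    have a2 := prabhakarIntegral_prabhakarKernel (ω := ω) (γ₁ := γ) hρ hiA hμ.1
    have a3 := prabhakarIntegral_comp (ω := ω) hρ hiA (iμ γ) hh
    rw [neg_add_eq_sub] at a2 a3
    filter_upwards [hyh, a1, a2, a3] with x e a1 a2 a3
    rw [e, hZ, a1, Pi.add_apply, Pi.add_apply, Pi.smul_apply, Pi.smul_apply, a2, a3]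
  have lδZ := lZ.prabhakarIntegral (ω := ω) hρ (iμ δ)
  -- From `f = A h - lam E(μ,δ) y` and `y = A Z`, since `A` commutes with `E(μ,δ)`.
  refine ⟨h + (-lam) • prabhakarIntegral ρ μ ω δ Z, hh.add (lδZ.smul _), ?_⟩
  have b1 := prabhakarIntegral_add (ω := ω) hρ hiA hh (lδZ.smul (-lam))
  rw [prabhakarIntegral_smul hiA] at b1
  have b2 := prabhakarIntegral_comp (ω := ω) hρ hiA (iμ δ) lZ
  have b3 := (prabhakarIntegral_congr (ρ := ρ) (ω := ω) (iμ δ) hyZ).trans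
    (prabhakarIntegral_comp hρ (iμ δ) hiA lZ)
  rw [add_comm μ, add_comm δ] at b3
  filter_upwards [hA, b1, b2, b3] with x e b1 b2 b3
  simp only [Pi.add_apply, Pi.smul_apply, smul_eq_mul] at e b1 ⊢
  rw [b1, b2, ← b3, ← e]
  ring

theorem isCauchySolution_cauchyFormula (hρ : 0 < ρ) (hμ : μ ∈ Ioo (0 : ℝ) 1)
    (hν : ν ∈ Icc (0 : ℝ) 1) (hγ : 0 ≤ γ) (hδ : 0 ≤ δ) (hf : LocL1 f) {g : ℝ → ℂ} (hg : LocL1 g)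
    (hfg : f =ᵖ prabhakarIntegral ρ (ν * (1 - μ)) ω (-(γ * ν)) g) :
    IsCauchySolution ρ ω γ μ ν δ lam K f (cauchyFormula ρ ω γ μ ν δ lam K f) := by
  have hiA := isPrabhakarIndex_outer hμ hν γ
  have hpos : 0 < ν * (1 - μ) + μ :=
    add_pos_of_nonneg_of_pos (mul_nonneg hν.1 (by linarith [hμ.2])) hμ.1
  have iC : IsPrabhakarIndex (ν * (1 - μ) + μ) (γ - γ * ν) := Or.inl hpos
  have iμ : ∀ γ', IsPrabhakarIndex μ γ' := fun _ => Or.inl hμ.1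
  have i2μ : IsPrabhakarIndex (2 * μ) (δ + γ) := Or.inl (mul_pos two_pos hμ.1)
  have hσ := add_nonneg hδ hγ
  have lk := locL1_prabhakarKernel hρ hμ.1 ω γ
  set T := resolventKernel ρ μ ω lam (δ + γ) μ γ with hT
  have lT : LocL1 T := locL1_resolventKernel hρ hμ.1 hσ hμ.1 hγ
  set Z := (K : ℂ) • T + causalConv T g with hZ
  have lZ : LocL1 Z := (lT.smul _).add (lT.causalConv hg)
  have hYZ : cauchyFormula ρ ω γ μ ν δ lam K f =ᵖ
      prabhakarIntegral ρ (ν * (1 - μ)) ω (-(γ * ν)) Z := by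
    have a1 := prabhakarIntegral_add (ω := ω) hρ hiA (lT.smul (K : ℂ)) (lT.causalConv hg)
    rw [prabhakarIntegral_smul hiA] at a1
    have a2 := prabhakarIntegral_resolventKernel (ω := ω) (lam := lam) hρ hiA hμ.1 hσ hμ.1 hγ
    rw [neg_add_eq_sub] at a2
    have a3 := prabhakarIntegral_causalConv (ω := ω) hρ hiA hg lT
    rw [causalConv_comm g, causalConv_comm _ T] at a3
    have a4 := causalConv_congr (EventuallyEq.refl _ T) hfg
    filter_upwards [cauchyFormula_eventuallyEq (K := K) (ω := ω) (lam := lam) hρ hμ hγ hδ hf,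
      a1, a2, a3, a4] with x e a1 a2 a3 a4
    rw [e, hZ, a1, Pi.add_apply, Pi.add_apply, Pi.smul_apply, Pi.smul_apply, a2, a3, a4]
  have lY : LocL1 (cauchyFormula ρ ω γ μ ν δ lam K f) :=
    (lZ.prabhakarIntegral (ω := ω) hρ hiA).congr hYZ.symm
  have lδZ := lZ.prabhakarIntegral (ω := ω) hρ (iμ δ)
  -- The density is forced formally by `A h = lam E(μ,δ) A Z + A g`: cancel `A`.
  refine IsCauchySolution.of_density hρ hμ hν (h := g + lam • prabhakarIntegral ρ μ ω δ Z) lY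
    (hg.add (lδZ.smul _)) ?_ ?_
  · have b1 := prabhakarIntegral_add (ω := ω) hρ hiA hg (lδZ.smul lam)
    rw [prabhakarIntegral_smul hiA] at b1
    have b2 := prabhakarIntegral_comp (ω := ω) hρ hiA (iμ δ) lZ
    have b3 := (prabhakarIntegral_congr (ρ := ρ) (ω := ω) (iμ δ) hYZ).trans
      (prabhakarIntegral_comp hρ (iμ δ) hiA lZ)
    rw [add_comm μ, add_comm δ] at b3
    filter_upwards [hfg, b1, b2, b3] with x e b1 b2 b3
    simp only [Pi.add_apply, Pi.smul_apply, smul_eq_mul] at b1 ⊢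
    rw [b1, b2, b3, e]
    ring
  -- Apply `A` to the Volterra equation for `Z`; its last two terms combine to the complementary
  -- operator applied to the density.
  · have hV := volterra_resolvent (ω := ω) (lam := lam) hρ hμ.1 hσ hγ (K : ℂ) hg hZ
    rw [← prabhakarIntegral_of_pos hμ.1, ← prabhakarIntegral_of_pos (mul_pos two_pos hμ.1)] at hV
    have lg := hg.prabhakarIntegral (ω := ω) hρ (iμ γ)
    have l2 := lZ.prabhakarIntegral (ω := ω) hρ i2μ
    have c1 := prabhakarIntegral_congr (ρ := ρ) (ω := ω) hiA hV
    have c2 := prabhakarIntegral_add (ω := ω) hρ hiA ((lk.smul (K : ℂ)).add lg) (l2.smul lam)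
    have c3 := prabhakarIntegral_add (ω := ω) hρ hiA (lk.smul (K : ℂ)) lg
    rw [prabhakarIntegral_smul hiA] at c2 c3
    have c4 := prabhakarIntegral_prabhakarKernel (ω := ω) (γ₁ := γ) hρ hiA hμ.1
    have c5 := prabhakarIntegral_comp (ω := ω) hρ hiA (iμ γ) hg
    rw [neg_add_eq_sub] at c4 c5
    have c6 := prabhakarIntegral_comp (ω := ω) hρ hiA i2μ lZ
    have d1 := prabhakarIntegral_add (ω := ω) hρ iC hg (lδZ.smul lam)
    rw [prabhakarIntegral_smul iC] at d1
    have d2 := prabhakarIntegral_comp (ω := ω) hρ iC (iμ δ) lZ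
    rw [show ν * (1 - μ) + μ + μ = ν * (1 - μ) + 2 * μ by ring,
      show γ - γ * ν + δ = -(γ * ν) + (δ + γ) by ring] at d2
    filter_upwards [hYZ, c1, c2, c3, c4, c5, c6, d1, d2] with x e c1 c2 c3 c4 c5 c6 d1 d2
    simp only [Pi.add_apply, Pi.smul_apply, smul_eq_mul] at c1 c2 c3 d1 ⊢
    rw [e, c1, c2, c3, c4, c5, c6, d1, d2]
    ring

end Cauchy

theorem theorem4p1 (ρ μ ν γ δ K : ℝ) (ω lam : ℂ) (f : ℝ → ℂ)
    (hρ : 0 < ρ) (hμ : μ ∈ Ioo (0 : ℝ) 1) (hν : ν ∈ Icc (0 : ℝ) 1)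
    (hγ : 0 ≤ γ) (hδ : 0 ≤ δ) (hK : 0 ≤ K) (hf : IntegrableOn f (Ioi 0)) :
    -- every Mittag-Leffler series in the formula converges
    (∀ (n : ℕ) (z : ℂ), Summable fun k : ℕ =>
      (((ascPochhammer ℝ k).eval (γ - γ * ν + n * (δ + γ)) /
        (Real.Gamma (ρ * k + (ν * (1 - μ) + μ * (2 * n + 1))) * k.factorial) : ℝ) : ℂ) * z ^ k) ∧
    -- the first series of the formula converges for every `x > 0`
    (∀ x : ℝ, 0 < x → Summable fun n : ℕ =>
      lam ^ n * ((x ^ (ν * (1 - μ) + μ * (2 * n + 1) - 1) : ℝ) : ℂ) *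
        prabhakarE ρ (ν * (1 - μ) + μ * (2 * n + 1)) (γ - γ * ν + n * (δ + γ))
          (ω * ((x ^ ρ : ℝ) : ℂ))) ∧
    -- for almost every `x > 0` its Prabhakar integrals exist and the second series converges
    (∀ᵐ x ∂(volume.restrict (Ioi (0 : ℝ))),
      (∀ n : ℕ, IntervalIntegrable
        (fun s => prabhakarKernel ρ ((2 * n + 1) * μ) ω (γ + n * (δ + γ)) (x - s) * f s)
        volume 0 x) ∧
      Summable fun n : ℕ =>
        lam ^ n * prabhakarIntegral ρ ((2 * n + 1) * μ) ω (γ + n * (δ + γ)) f x) ∧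
    -- every solution is given by the formula
    (∀ y : ℝ → ℂ, IsCauchySolution ρ ω γ μ ν δ lam K f y →
      y =ᵐ[volume.restrict (Ioi 0)] cauchyFormula ρ ω γ μ ν δ lam K f) ∧
    -- the formula is a solution exactly if `f` is in the range of the outer operator of `𝐃`
    (IsCauchySolution ρ ω γ μ ν δ lam K f (cauchyFormula ρ ω γ μ ν δ lam K f) ↔
      ∃ g : ℝ → ℂ, LocL1 g ∧
        f =ᵐ[volume.restrict (Ioi 0)] prabhakarIntegral ρ (ν * (1 - μ)) ω (-(γ * ν)) g) ∧
    -- in particular it is a solution for every integrable `f` if `ν = 0`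
    (ν = 0 → IsCauchySolution ρ ω γ μ ν δ lam K f (cauchyFormula ρ ω γ μ ν δ lam K f)) := by
  have lf : LocL1 f := fun b _ => hf.mono_set Ioc_subset_Ioi_self
  have hσ := add_nonneg hδ hγ
  have hpos : 0 < ν * (1 - μ) + μ :=
    add_pos_of_nonneg_of_pos (mul_nonneg hν.1 (by linarith [hμ.2])) hμ.1
  refine ⟨fun n z => ?_, fun x hx => ?_, ?_, fun y hy => ?_,
    ⟨exists_range_of_isCauchySolution hρ hμ hν, fun ⟨g, hg, hfg⟩ =>
      isCauchySolution_cauchyFormula hρ hμ hν hγ hδ lf hg hfg⟩, ?_⟩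
  · have hβ : 0 < ν * (1 - μ) + μ * (2 * n + 1) := by
      have : 0 ≤ μ * (2 * n) := mul_nonneg hμ.1.le (by positivity)
      linarith
    -- At `t = 1` and `ω = z` the terms of the kernel are those of the Mittag-Leffler series.
    refine (summable_norm_prabhakarTerm hρ hβ z (γ - γ * ν + n * (δ + γ)) one_pos).of_norm.congr
      fun k => ?_
    simp only [prabhakarTerm, rlKernel, pochCoeff, Pi.smul_apply, smul_eq_mul, Real.one_rpow]
    push_cast
    ring
  · have h := ((locL1Summable_resolventTerm (ω := ω) (lam := lam) hρ hμ.1 hσ hpos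
      (by nlinarith [hν.2] : 0 ≤ γ - γ * ν)).summable x hx).of_norm
    refine h.congr fun n => ?_
    simp only [resolventTerm, Pi.smul_apply, smul_eq_mul, prabhakarKernel]
    rw [show ν * (1 - μ) + μ * (2 * n + 1) = ν * (1 - μ) + μ + n * (2 * μ) by ring, mul_assoc]
  · have hn : ∀ n : ℕ, 0 < (2 * n + 1) * μ := fun n => mul_pos (by positivity) hμ.1
    have h1 := ae_all_iff.2 fun n : ℕ =>
      (locL1_prabhakarKernel hρ (hn n) ω (γ + n * (δ + γ))).ae_intervalIntegrable lf
    have h2 := (locL1Summable_resolventTerm (ω := ω) (lam := lam) hρ hμ.1 hσ hμ.1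
      hγ).hasSum_causalConv lf
    filter_upwards [h1, h2] with x h1 h2
    refine ⟨h1, h2.summable.congr fun n => ?_⟩
    rw [prabhakarIntegral_of_pos (hn n), resolventTerm, causalConv_smul_left, Pi.smul_apply,
      smul_eq_mul, show (2 * n + 1) * μ = μ + n * (2 * μ) by ring]
  · exact hy.eventuallyEq_cauchyFormula hρ hμ hν hγ hδ lf
  · rintro rfl
    -- For `ν = 0` the outer operator is the identity, so `f` is its own preimage.
    refine isCauchySolution_cauchyFormula hρ hμ hν hγ hδ lf lf ?_
    rw [zero_mul, mul_zero, neg_zero, prabhakarIntegral_zero_zero]
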